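/- Let $G$ be a finite acyclic directed graph. Write $a\le b$ ($G$-order) if there is a directed path from $b$ to $a$. **Tops.** A pair $(\mathcal D,\mathcal U)$ of disjoint independent sets of $G$ is *orthogonal* if there is no edge from an element of $\mathcal D$ to an element of $\mathcal U$. It is *tight* if it is orthogonal and no longer gives an orthogonal pair of independent sets after adding to $\mathcal D$ a vertex $g\notin\mathcal D$, possibly removing from $\mathcal D$ some elements smaller than $g$, nor after adding to $\mathcal U$ a vertex $g\notin\mathcal U$, possibly removing from $\mathcal U$ some elements larger than $g$. Let $\mathrm{top}(G)$ be the set of tight orthogonal pairs. Fix a linear extension $\ell$ of $G$-order and a reverse linear extension $\ell'$. For $g\in\mathcal D\cup\mathcal U$, $\mathrm{flip}_g(\mathcal D,\mathcal U)$ is the result of the following procedure: delete from $\mathcal D$ all elements less than $g$ and from $\mathcal U$ all elements greater than $g$; move $g$ to the other set; then, for $k$ in the order $\ell'$, add $k$ to $\mathcal D$ if $k\not\ge g$, $k\notin\mathcal U$, there is no edge from $k$ to the current $\mathcal U$ and no edge from the current $\mathcal D$ to $k$; then, for $k$ in the order $\ell$, add $k$ to $\mathcal U$ if $k\not\le g$,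 $k\notin\mathcal D$, there is no edge from the current $\mathcal D$ to $k$ and no edge from $k$ to the current $\mathcal U$. Order $\mathrm{top}(G)$ by the reflexive and transitive closure of the relations $(\mathcal D,\mathcal U)<\mathrm{flip}_g(\mathcal D,\mathcal U)$ with $g\in\mathcal U$. **Mops.** Let $\mathcal L(G)$ be the lattice of maximal orthogonal pairs of $G$: pairs $(X,Y)$ of disjoint sets of vertices with no edge from $X$ to $Y$, such that neither $X$ nor $Y$ can be enlarged with these properties, ordered by $(X,Y)\le(X',Y')$ iff $X\subseteq X'$. For $x=(X,Y)$ write $x_{\mathcal J}=X$ and $x_{\mathcal M}=Y$. A finite lattice is *extremal* if the length of its longest chain equals both its number of join irreducible elements and its number of meet irreducible elements. An element $x$ of a lattice is *left modular* if $(y\vee x)\wedge z=y\vee(x\wedge z)$ for all $y\le z$; a lattice is *left modular* if it has a maximal chain of left modular elements; and it is *trim* if it is extremal and left modular. **Theorem.** The lattice $\mathcal L(G)$ is trim if and only if the poset $\mathrm{top}(G)$ is a lattice. If $\mathcal L(G)$ is trim, then for every cover relation $x\lessdot y$ of $\mathcal L(G)$ the set $x_{\mathcal M}\cap y_{\mathcal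 J}$ has exactly one element, and, with $$\mathrm D(y)=\{\text{the element of }x_{\mathcal M}\cap y_{\mathcal J}: x\lessdot y\},\qquad \mathrm U(y)=\{\text{the element of }y_{\mathcal M}\cap z_{\mathcal J}: y\lessdot z\},$$ the map $\phi(x)=(\mathrm D(x),\mathrm U(x))$ is an isomorphism of posets $\mathcal L(G)\simeq\mathrm{top}(G)$. -/

import Mathlib

/-- An acyclic directed graph on the vertex type `V`: a digraph in which no directed path of
positive length returns to its starting vertex. -/
structure AcyclicDigraph (V : Type*) extends Digraph V where
  acyclic : ∀ v, ¬ Relation.TransGen Adj v v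

namespace AcyclicDigraph

variable {V : Type*} (G : AcyclicDigraph V)

/-! ### The `G`-order and its linear extensions -/

/-- The `G`-order: `a ≤ b` iff there is a directed path (possibly of length `0`) from `b` to `a`. -/
def Le (a b : V) : Prop := Relation.ReflTransGen G.Adj b a

/-- The strict `G`-order: `a < b` iff there is a directed path of positive length from `b` to `a`. -/
def Lt (a b : V) : Prop := Relation.TransGen G.Adj b a

theorem lt_iff_le_and_ne (a b : V) : G.Lt a b ↔ G.Le a b ∧ a ≠ b := by
  constructor
  · intro h
    refine ⟨h.to_reflTransGen, ?_⟩
    rintro rfl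
    exact G.acyclic _ h
  · rintro ⟨h, hne⟩
    rcases Relation.reflTransGen_iff_eq_or_transGen.1 h with h | h
    · exact absurd h hne
    · exact h

/-- The list `l` enumerates all the vertices, each exactly once, in an order that is a linear
extension of the `G`-order: whenever there is an edge `a → b`, the vertex `b` precedes `a`. -/
structure IsLinearExtension (l : List V) : Prop where
  nodup : l.Nodup
  mem : ∀ v, v ∈ l
  pairwise : l.Pairwise fun a b => ¬ G.Adj a b

/-- A reverse linear extension: whenever there is an edge `a → b`, the vertex `a` precedes `b`. -/
structure IsReverseLinearExtension (l : List V) : Prop where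
  nodup : l.Nodup
  mem : ∀ v, v ∈ l
  pairwise : l.Pairwise fun a b => ¬ G.Adj b a

/-! ### Tight orthogonal pairs -/

/-- An independent set: no two of its vertices are joined by an edge. -/
def IsIndependent (A : Set V) : Prop := ∀ a ∈ A, ∀ b ∈ A, ¬ G.Adj a b

/-- An orthogonal pair of independent sets: `D` and `U` are disjoint independent sets and there is
no edge from an element of `D` to an element of `U`. -/
structure IsOrthogonal (D U : Set V) : Prop where
  independent_left : G.IsIndependent D
  independent_right : G.IsIndependent U
  disjoint : Disjoint D U
  not_adj : ∀ d ∈ D, ∀ u ∈ U, ¬ G.Adj d u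

/-- A tight orthogonal pair of independent sets. In `not_increase`, the vertex `g` is a new element
of `D` which replaces the elements of a set `S` of smaller elements of `D`: for `S = ∅` it is added
to `D`, and for `S = {d}` the element `d` is increased to `g`. Dually in `not_decrease`. -/
structure IsTight (D U : Set V) : Prop where
  orthogonal : G.IsOrthogonal D U
  not_increase : ∀ g ∉ D, ∀ S ⊆ D, (∀ d ∈ S, G.Lt d g) → ¬ G.IsOrthogonal (insert g (D \ S)) U
  not_decrease : ∀ g ∉ U, ∀ S ⊆ U, (∀ u ∈ S, G.Lt g u) → ¬ G.IsOrthogonal D (insert g (U \ S))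

/-! ### Flips -/

open Classical in
/-- Run through the list `l`, adding each vertex `k` for which the condition `P k` holds for the
set built so far. -/
noncomputable def greedy (P : V → Set V → Prop) (l : List V) (S : Set V) : Set V :=
  l.foldl (fun T k => if P k T then insert k T else T) S

/-- The greedy completion step of the flip at `g`. First `D` is completed along `l'` by vertices `k`
not above `g`, then `U` is completed along `l` by vertices `k` not below `g`. -/
noncomputable def complete (l l' : List V) (g : V) (D U : Set V) : Set V × Set V :=
  let D' := greedy (fun k T => ¬ G.Le g k ∧ k ∉ U ∧ (∀ i ∈ U, ¬ G.Adj k i) ∧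
    ∀ i ∈ T, ¬ G.Adj i k) l' D
  let U' := greedy (fun k T => ¬ G.Le k g ∧ k ∉ D' ∧ (∀ i ∈ D', ¬ G.Adj i k) ∧
    ∀ i ∈ T, ¬ G.Adj k i) l U
  (D', U')

open Classical in
/-- The flip of the pair `p = (D, U)` at the vertex `g`: if `g ∈ D ∪ U`, then keep the elements of
`D` not less than `g` and the elements of `U` not greater than `g`, switch the set to which `g`
belongs, and complete greedily. -/
noncomputable def flip (l l' : List V) (g : V) (p : Set V × Set V) : Set V × Set V :=
  if g ∈ p.2 then
    G.complete l l' g (insert g {k ∈ p.1 | ¬ G.Le k g}) {k ∈ p.2 | ¬ G.Le g k}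
  else if g ∈ p.1 then
    G.complete l l' g {k ∈ p.1 | ¬ G.Le k g} (insert g {k ∈ p.2 | ¬ G.Le g k})
  else p

/-! ### The independence poset `top(G)` -/

/-- The set of tight orthogonal pairs of `G`. The linear extension `l` and the reverse linear
extension `l'` are those used in the greedy completions that define flips. -/
@[ext]
structure Tops (l l' : List V) where
  D : Set V
  U : Set V
  tight : G.IsTight D U

variable {G}

namespace Tops

variable {l l' : List V}

/-- `y` is obtained from `x` by an upward flip at some element of `x.U`. -/
def UpFlip (x y : G.Tops l l') : Prop := ∃ g ∈ x.U, G.flip l l' g (x.D, x.U) = (y.D, y.U)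

end Tops

theorem subset_greedy (P : V → Set V → Prop) (l : List V) (S : Set V) : S ⊆ greedy P l S := by
  classical
  unfold greedy
  induction l generalizing S with
  | nil => exact subset_rfl
  | cons a l ih =>
    rw [List.foldl_cons]
    refine Set.Subset.trans ?_ (ih _)
    split_ifs
    · exact Set.subset_insert _ _
    · exact subset_rfl

/-- After an upward flip at `g`, the vertex `g` lies in the new `D`, as does every element of the
old `D` that is not below `g`. -/
theorem mem_of_flip_eq {l l' : List V} {x y : G.Tops l l'} {g : V} (hg : g ∈ x.U)
    (h : G.flip l l' g (x.D, x.U) = (y.D, y.U)) {k : V} (hk : k = g ∨ k ∈ x.D ∧ ¬ G.Le k g) :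
    k ∈ y.D := by
  have h1 : (G.flip l l' g (x.D, x.U)).1 = y.D := by rw [h]
  rw [← h1, flip, if_pos hg]
  exact subset_greedy _ _ _ hk

/-- The independence poset `top(G)`: the reflexive and transitive closure of the upward flips. -/
instance instPartialOrderTops [Finite V] {l l' : List V} : PartialOrder (G.Tops l l') where
  le := Relation.ReflTransGen Tops.UpFlip
  le_refl _ := Relation.ReflTransGen.refl
  le_trans _ _ _ := Relation.ReflTransGen.trans
  le_antisymm x y hxy hyx := by
    by_contra hne
    let S : Set V := {g | ∃ a b : G.Tops l l', Relation.ReflTransGen Tops.UpFlip x a ∧ g ∈ a.U ∧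
      G.flip l l' g (a.D, a.U) = (b.D, b.U) ∧ Relation.ReflTransGen Tops.UpFlip b x}
    have hS : S.Nonempty := by
      rcases Relation.ReflTransGen.cases_head hxy with h | ⟨b, ⟨g, hg, hb⟩, hby⟩
      · exact absurd h hne
      · exact ⟨g, x, b, .refl, hg, hb, hby.trans hyx⟩
    have : IsTrans V (fun a b => G.Lt b a) := ⟨fun a b c h1 h2 => Relation.TransGen.trans h1 h2⟩
    have : Std.Irrefl (fun a b => G.Lt b a) := ⟨fun a h => G.acyclic a h⟩
    obtain ⟨g, ⟨a, b, hxa, hga, hab, hbx⟩, hmax⟩ :=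
      (Finite.wellFounded_of_trans_of_irrefl (fun a b => G.Lt b a)).has_min S hS
    have key : ∀ c, Relation.ReflTransGen Tops.UpFlip b c →
        Relation.ReflTransGen Tops.UpFlip c a → g ∈ c.D := by
      intro c hbc
      induction hbc with
      | refl => exact fun _ => mem_of_flip_eq hga hab (.inl rfl)
      | @tail c d hbc hcd ih =>
        intro hda
        have hgc := ih (.head hcd hda)
        obtain ⟨h, hhc, hd⟩ := hcd
        refine mem_of_flip_eq hhc hd (.inr ⟨hgc, fun hle => ?_⟩)
        have hne' : g ≠ h := by
          rintro rfl
          exact Set.disjoint_left.1 c.tight.orthogonal.disjoint hgc hhc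
        refine hmax h ⟨c, d, hxa.trans (.head ⟨g, hga, hab⟩ hbc), hhc, hd, ?_⟩
          ((G.lt_iff_le_and_ne _ _).2 ⟨hle, hne'⟩)
        exact hda.trans (.head ⟨g, hga, hab⟩ hbx)
    have hgD := key a (hbx.trans hxa) .refl
    exact Set.disjoint_left.1 a.tight.orthogonal.disjoint hgD hga

variable (G)

/-! ### The lattice `L(G)` of maximal orthogonal pairs -/

/-- A maximal orthogonal pair: `X` and `Y` are disjoint, there is no edge from `X` to `Y`, and
neither `X` nor `Y` can be enlarged while keeping these properties. -/
structure IsMaximalOrthogonalPair (X Y : Set V) : Prop where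
  disjoint : Disjoint X Y
  not_adj : ∀ x ∈ X, ∀ y ∈ Y, ¬ G.Adj x y
  maximal_left : ∀ X', X ⊆ X' → Disjoint X' Y → (∀ x ∈ X', ∀ y ∈ Y, ¬ G.Adj x y) → X' = X
  maximal_right : ∀ Y', Y ⊆ Y' → Disjoint X Y' → (∀ x ∈ X, ∀ y ∈ Y', ¬ G.Adj x y) → Y' = Y

/-- The relation whose formal concepts are the maximal orthogonal pairs. -/
def NonEdge (x y : V) : Prop := x ≠ y ∧ ¬ G.Adj x y

/-- The lattice `L(G)` of maximal orthogonal pairs `(X, Y)`, ordered by inclusion of the first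
components: `X` is the `extent` and `Y` is the `intent` of a formal concept. That these are exactly
the maximal orthogonal pairs is `isMaximalOrthogonalPair_iff`. -/
abbrev Mops : Type _ := Concept V V G.NonEdge

theorem isMaximalOrthogonalPair_iff (X Y : Set V) :
    G.IsMaximalOrthogonalPair X Y ↔ ∃ c : G.Mops, c.extent = X ∧ c.intent = Y := by
  constructor
  · intro h
    have hXY : ∀ x ∈ X, ∀ y ∈ Y, G.NonEdge x y := fun x hx y hy =>
      ⟨fun e => Set.disjoint_left.1 h.disjoint hx (e ▸ hy), h.not_adj x hx y hy⟩
    refine ⟨⟨X, Y, ?_, ?_⟩, rfl, rfl⟩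
    · refine h.maximal_right _ (fun y hy x hx => hXY x hx y hy) ?_ fun x hx y hy => (hy hx).2
      exact Set.disjoint_left.2 fun x hx hx' => (hx' hx).1 rfl
    · refine h.maximal_left _ (fun x hx y hy => hXY x hx y hy) ?_ fun x hx y hy => (hx hy).2
      exact Set.disjoint_left.2 fun x hx hx' => (hx hx').1 rfl
  · rintro ⟨c, rfl, rfl⟩
    have hr : ∀ x ∈ c.extent, ∀ y ∈ c.intent, G.NonEdge x y := fun x hx y hy =>
      c.rel_extent_intent hx hy
    refine ⟨Set.disjoint_left.2 fun x hx hx' => (hr x hx x hx').1 rfl,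
      fun x hx y hy => (hr x hx y hy).2, ?_, ?_⟩
    · intro X' hX hd ha
      refine Set.Subset.antisymm (fun x hx => ?_) hX
      rw [← c.lowerPolar_intent]
      exact fun y hy => ⟨fun e => Set.disjoint_left.1 hd hx (e ▸ hy), ha x hx y hy⟩
    · intro Y' hY hd ha
      refine Set.Subset.antisymm (fun y hy => ?_) hY
      rw [← c.upperPolar_extent]
      exact fun x hx => ⟨fun e => Set.disjoint_left.1 hd hx (e ▸ hy), ha x hx y hy⟩

variable {G}

/-- The downward labels of `y ∈ L(G)`: the unique elements of `x_M ∩ y_J`, for `x ⋖ y`. -/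
def downLabels (y : G.Mops) : Set V := {g | ∃ x : G.Mops, x ⋖ y ∧ x.intent ∩ y.extent = {g}}

/-- The upward labels of `y ∈ L(G)`: the unique elements of `y_M ∩ z_J`, for `y ⋖ z`. -/
def upLabels (y : G.Mops) : Set V := {g | ∃ z : G.Mops, y ⋖ z ∧ y.intent ∩ z.extent = {g}}

end AcyclicDigraph

/-! ### Trim lattices -/

/-- A poset is a lattice if any two elements have a least upper bound and a greatest lower bound. -/
def IsLatticePoset (P : Type*) [PartialOrder P] : Prop :=
  ∀ x y : P, (∃ z, IsLUB {x, y} z) ∧ ∃ z, IsGLB {x, y} z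

/-- An extremal lattice (for finite nonempty lattices): the length of a longest chain equals both
the number of join irreducible elements and the number of meet irreducible elements. -/
def IsExtremal (L : Type*) [Lattice L] : Prop :=
  ∃ p : LTSeries L, (∀ q : LTSeries L, q.length ≤ p.length) ∧
    p.length = Nat.card {j : L // SupIrred j} ∧ p.length = Nat.card {m : L // InfIrred m}

/-- A left modular element of a lattice. -/
def IsLeftModularElement {L : Type*} [Lattice L] (x : L) : Prop :=
  ∀ y z : L, y ≤ z → (y ⊔ x) ⊓ z = y ⊔ (x ⊓ z)

/-- A left modular lattice has a maximal chain of left modular elements. -/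
def IsLeftModularLattice (L : Type*) [Lattice L] : Prop :=
  ∃ C : Set L, IsMaxChain (· ≤ ·) C ∧ ∀ x ∈ C, IsLeftModularElement x

/-- A trim lattice is an extremal left modular lattice. -/
def IsTrim (L : Type*) [Lattice L] : Prop := IsExtremal L ∧ IsLeftModularLattice L

/-! The pivot is the condition `IsOverlapping`: every cover `c ⋖ d` of `L(G)` has a vertex in
`c.intent ∩ d.extent`. Acyclicity makes this vertex, the label of the cover, unique
(`CovBy.label_unique`). Both trimness of `L(G)` and the lattice property of `top(G)` turn out to be
equivalent to it.

Trim iff overlapping. `L(G)` is always extremal: its join and meet irreducibles correspond to the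
vertices, and the initial segments of a linear extension form a chain of length `|V|`. When covers
overlap, a pair with extent and intent covering `V` is left modular, so the chain of initial
segments is a left modular maximal chain. Conversely, the elements of any left modular maximal chain
cover `V`, and comparing a cover with this chain produces a label.

Overlapping implies lattice. The labels below and above an element form a tight pair, and covers
become flips. This gives a bijection `IsOverlapping.toTops` preserving and reflecting the order.

Lattice implies overlapping. Write `j_g` for the top with `D = {g}` and `m_h` for the one with `U =
{h}`. If `top(G)` is a lattice, then `j_g ≤ m_h` holds exactly when `NonEdge g h` (`D_le_U_iff`), so
each concept comes from a top, and the label of a flip witnesses the overlap.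

Duality under `op`, which reverses edges and swaps components, halves most arguments. -/

namespace AcyclicDigraph

/-! ### The `G`-order -/

section Order

variable {V : Type*} (G : AcyclicDigraph V)

/-- The opposite digraph, with all edges reversed. -/
def op : AcyclicDigraph V where
  Adj a b := G.Adj b a
  acyclic v h := G.acyclic v (Relation.transGen_swap.1 h)

theorem op_adj {a b : V} : G.op.Adj a b ↔ G.Adj b a := Iff.rfl

theorem op_le {a b : V} : G.op.Le a b ↔ G.Le b a := Relation.reflTransGen_swap

theorem op_lt {a b : V} : G.op.Lt a b ↔ G.Lt b a := Relation.transGen_swap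

variable {G}

theorem Le.refl (a : V) : G.Le a a := Relation.ReflTransGen.refl

theorem Le.trans {a b c : V} (h : G.Le a b) (h' : G.Le b c) : G.Le a c :=
  Relation.ReflTransGen.trans h' h

theorem lt_of_adj {a b : V} (h : G.Adj a b) : G.Lt b a := Relation.TransGen.single h

theorem le_of_adj {a b : V} (h : G.Adj a b) : G.Le b a := Relation.ReflTransGen.single h

theorem Lt.le {a b : V} (h : G.Lt a b) : G.Le a b := Relation.TransGen.to_reflTransGen h

theorem Lt.trans {a b c : V} (h : G.Lt a b) (h' : G.Lt b c) : G.Lt a c :=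
  Relation.TransGen.trans h' h

theorem Lt.trans_le {a b c : V} (h : G.Lt a b) (h' : G.Le b c) : G.Lt a c :=
  Relation.TransGen.trans_right h' h

theorem Le.trans_lt {a b c : V} (h : G.Le a b) (h' : G.Lt b c) : G.Lt a c :=
  Relation.TransGen.trans_left h' h

theorem not_le_of_lt {a b : V} (h : G.Lt a b) : ¬ G.Le b a := fun h' =>
  G.acyclic _ (h.trans_le h')

theorem Le.antisymm {a b : V} (h : G.Le a b) (h' : G.Le b a) : a = b := by
  by_contra hne
  exact not_le_of_lt ((G.lt_iff_le_and_ne a b).2 ⟨h, hne⟩) h'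

theorem Le.lt_of_ne {a b : V} (h : G.Le a b) (hne : a ≠ b) : G.Lt a b :=
  (G.lt_iff_le_and_ne a b).2 ⟨h, hne⟩

theorem not_adj_self (a : V) : ¬ G.Adj a a := fun h => G.acyclic a (.single h)

variable (G)

theorem wellFounded_gt [Finite V] : WellFounded fun a b => G.Lt b a := by
  have : IsTrans V (fun a b => G.Lt b a) := ⟨fun a b c h1 h2 => h2.trans h1⟩
  have : Std.Irrefl (fun a b => G.Lt b a) := ⟨fun a h => G.acyclic a h⟩
  exact Finite.wellFounded_of_trans_of_irrefl _

theorem wellFounded_lt [Finite V] : WellFounded G.Lt := by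
  have h : G.Lt = fun a b => G.op.Lt b a := by
    funext a b
    exact propext G.op_lt.symm
  rw [h]
  exact G.op.wellFounded_gt

variable {G}

theorem IsLinearExtension.op {l : List V} (h : G.IsLinearExtension l) :
    G.op.IsReverseLinearExtension l := ⟨h.nodup, h.mem, h.pairwise⟩

theorem IsReverseLinearExtension.op {l : List V} (h : G.IsReverseLinearExtension l) :
    G.op.IsLinearExtension l := ⟨h.nodup, h.mem, h.pairwise⟩

end Order

/-! ### Greedy sets and kernels -/

section Greedy

variable {V : Type*}

/-- Vertices later in the list have no `B`-relation to earlier ones, so testing `k` against the set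
built so far is the same as testing it against the final set. The greedy set thus becomes the
solution of a recursive equation. -/
theorem mem_greedy_iff {A : V → Prop} {B : V → V → Prop} {l : List V}
    (hl : l.Pairwise fun a b => ¬ B b a) (hB : ∀ a, ¬ B a a) (S : Set V) (k : V) :
    k ∈ greedy (fun k T => A k ∧ ∀ i ∈ T, ¬ B i k) l S ↔ k ∈ S ∨ k ∈ l ∧ A k ∧
      ∀ i ∈ greedy (fun k T => A k ∧ ∀ i ∈ T, ¬ B i k) l S, ¬ B i k := by
  classical
  induction l generalizing S k with
  | nil => simp [greedy]
  | cons a l ih =>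
    rw [List.pairwise_cons] at hl
    have ih' := ih hl.2
    have hcons : greedy (fun k T => A k ∧ ∀ i ∈ T, ¬ B i k) (a :: l) S =
        greedy (fun k T => A k ∧ ∀ i ∈ T, ¬ B i k) l
          (if A a ∧ ∀ i ∈ S, ¬ B i a then insert a S else S) := by
      simp only [greedy, List.foldl_cons]
      congr 1
      split_ifs <;> rfl
    rw [hcons]
    have hsub := subset_greedy (fun k T => A k ∧ ∀ i ∈ T, ¬ B i k) l
      (if A a ∧ ∀ i ∈ S, ¬ B i a then insert a S else S)
    have ih'' := ih' (if A a ∧ ∀ i ∈ S, ¬ B i a then insert a S else S)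
    generalize greedy (fun k T => A k ∧ ∀ i ∈ T, ¬ B i k) l
      (if A a ∧ ∀ i ∈ S, ¬ B i a then insert a S else S) = R at *
    by_cases hP : A a ∧ ∀ i ∈ S, ¬ B i a
    · rw [if_pos hP] at ih'' hsub
      have ha : ∀ i ∈ R, ¬ B i a := by
        intro i hi
        rcases (ih'' i).1 hi with (rfl | h) | ⟨h, -⟩
        · exact hB _
        · exact hP.2 i h
        · exact hl.1 i h
      constructor
      · intro hk
        rcases (ih'' k).1 hk with (rfl | h) | ⟨h, h'⟩
        · exact .inr ⟨by simp, hP.1, ha⟩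
        · exact .inl h
        · exact .inr ⟨by simp [h], h'⟩
      · rintro (h | ⟨h, h'⟩)
        · exact hsub (.inr h)
        · rcases List.mem_cons.1 h with rfl | h
          · exact hsub (.inl rfl)
          · exact (ih'' k).2 (.inr ⟨h, h'⟩)
    · rw [if_neg hP] at ih'' hsub
      constructor
      · intro hk
        rcases (ih'' k).1 hk with h | ⟨h, h'⟩
        · exact .inl h
        · exact .inr ⟨by simp [h], h'⟩
      · rintro (h | ⟨h, h'⟩)
        · exact hsub h
        · rcases List.mem_cons.1 h with rfl | h
          · exact absurd ⟨h'.1, fun i hi => h'.2 i (hsub hi)⟩ hP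
          · exact (ih'' k).2 (.inr ⟨h, h'⟩)

variable {G : AcyclicDigraph V}

variable (G) in
/-- The kernel of the subgraph induced on `X`: an independent subset `D` of `X` such that every
other vertex of `X` receives an edge from `D`. -/
def IsKernel (X D : Set V) : Prop := ∀ k, k ∈ D ↔ k ∈ X ∧ ∀ d ∈ D, ¬ G.Adj d k

theorem IsReverseLinearExtension.exists_isKernel {l : List V} (hl : G.IsReverseLinearExtension l)
    (X : Set V) : ∃ D, G.IsKernel X D := by
  refine ⟨greedy (fun k T => k ∈ X ∧ ∀ i ∈ T, ¬ G.Adj i k) l ∅, fun k => ?_⟩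
  rw [mem_greedy_iff (A := fun k => k ∈ X) hl.pairwise not_adj_self]
  simp [hl.mem]

theorem IsKernel.subset {X D : Set V} (h : G.IsKernel X D) : D ⊆ X := fun k hk => ((h k).1 hk).1

theorem IsKernel.not_adj {X D : Set V} (h : G.IsKernel X D) {d k : V} (hd : d ∈ D) (hk : k ∈ D) :
    ¬ G.Adj d k := ((h k).1 hk).2 d hd

theorem IsKernel.exists_adj {X D : Set V} (h : G.IsKernel X D) {k : V} (hk : k ∈ X)
    (hk' : k ∉ D) : ∃ d ∈ D, G.Adj d k := by
  by_contra! hc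
  exact hk' ((h k).2 ⟨hk, hc⟩)

/-- Kernels of two sets agree outside the vertices below `g`, if the sets do. -/
theorem IsKernel.mem_iff_of_not_le [Finite V] {X X' D D' : Set V} (h : G.IsKernel X D)
    (h' : G.IsKernel X' D') {g : V} (hX : ∀ k, ¬ G.Le k g → (k ∈ X ↔ k ∈ X')) {k : V}
    (hk : ¬ G.Le k g) : k ∈ D ↔ k ∈ D' := by
  induction k using G.wellFounded_gt.induction with
  | _ k ih =>
    rw [h k, h' k, hX k hk]
    have : ∀ d, G.Adj d k → (d ∈ D ↔ d ∈ D') := fun d hd =>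
      ih d (lt_of_adj hd) fun hdg => hk ((le_of_adj hd).trans hdg)
    refine and_congr_right fun _ => forall_congr' fun d => ?_
    by_cases hd : G.Adj d k
    · simp [this d hd, hd]
    · simp [hd]

theorem IsKernel.unique [Finite V] {X D D' : Set V} (h : G.IsKernel X D)
    (h' : G.IsKernel X D') : D = D' := by
  ext k
  induction k using G.wellFounded_gt.induction with
  | _ k ih =>
    rw [h k, h' k]
    refine and_congr_right fun _ => forall_congr' fun d => ?_
    by_cases hd : G.Adj d k
    · simp [ih d (lt_of_adj hd), hd]
    · simp [hd]

end Greedy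

/-! ### Tight pairs -/

section Tight

variable {V : Type*} {G : AcyclicDigraph V}

theorem IsOrthogonal.op {D U : Set V} (h : G.IsOrthogonal D U) : G.op.IsOrthogonal U D :=
  ⟨fun a ha b hb => h.independent_right b hb a ha, fun a ha b hb => h.independent_left b hb a ha,
    h.disjoint.symm, fun u hu d hd => h.not_adj d hd u hu⟩

theorem IsTight.op {D U : Set V} (h : G.IsTight D U) : G.op.IsTight U D :=
  ⟨h.orthogonal.op, fun g hg S hS hS' ho =>
      h.not_decrease g hg S hS (fun u hu => G.op_lt.1 (hS' u hu)) ho.op,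
    fun g hg S hS hS' ho =>
      h.not_increase g hg S hS (fun u hu => G.op_lt.1 (hS' u hu)) ho.op⟩

/-- Otherwise `k` could replace all the smaller elements of `D`. Together with the converse below,
this turns tightness into a local condition on the vertices outside the pair. -/
theorem IsTight.exists_adj {D U : Set V} (h : G.IsTight D U) {k : V} (hD : k ∉ D) (hU : k ∉ U) :
    (∃ d ∈ D, G.Adj d k) ∨ ∃ u ∈ U, G.Adj k u := by
  by_contra! hc
  refine h.not_increase k hD {d ∈ D | G.Lt d k} (fun d hd => hd.1) (fun d hd => hd.2) ⟨?_,
    h.orthogonal.independent_right, ?_, ?_⟩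
  · rintro a (rfl | ⟨ha, ha'⟩) b (rfl | ⟨hb, hb'⟩) hab
    · exact not_adj_self _ hab
    · exact hb' ⟨hb, lt_of_adj hab⟩
    · exact hc.1 a ha hab
    · exact h.orthogonal.independent_left a ha b hb hab
  · rw [Set.disjoint_insert_left]
    exact ⟨hU, h.orthogonal.disjoint.mono_left Set.sdiff_subset⟩
  · rintro a (rfl | ⟨ha, -⟩) u hu
    · exact hc.2 u hu
    · exact h.orthogonal.not_adj a ha u hu

theorem isTight_of_exists_adj {D U : Set V} (h : G.IsOrthogonal D U)
    (h' : ∀ k, k ∉ D → k ∉ U → (∃ d ∈ D, G.Adj d k) ∨ ∃ u ∈ U, G.Adj k u) : G.IsTight D U := by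
  refine ⟨h, fun g hg S hS hS' ho => ?_, fun g hg S hS hS' ho => ?_⟩
  · rcases h' g hg (Set.disjoint_left.1 ho.disjoint (.inl rfl)) with ⟨d, hd, hdg⟩ | ⟨u, hu, hgu⟩
    · refine ho.independent_left d (.inr ⟨hd, fun hdS => ?_⟩) g (.inl rfl) hdg
      exact G.acyclic _ ((hS' d hdS).trans (lt_of_adj hdg))
    · exact ho.not_adj g (.inl rfl) u hu hgu
  · rcases h' g (Set.disjoint_right.1 ho.disjoint (.inl rfl)) hg with ⟨d, hd, hdg⟩ | ⟨u, hu, hgu⟩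
    · exact ho.not_adj d hd g (.inl rfl) hdg
    · refine ho.independent_right g (.inl rfl) u (.inr ⟨hu, fun huS => ?_⟩) hgu
      exact G.acyclic _ ((hS' u huS).trans (lt_of_adj hgu))

/-- The first component of a tight pair is the kernel of the set of vertices which are not joined
to the second component. -/
theorem IsTight.isKernel {D U : Set V} (h : G.IsTight D U) :
    G.IsKernel {k | k ∉ U ∧ ∀ u ∈ U, ¬ G.Adj k u} D := by
  intro k
  constructor
  · exact fun hk => ⟨⟨Set.disjoint_left.1 h.orthogonal.disjoint hk, h.orthogonal.not_adj k hk⟩,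
      fun d hd => h.orthogonal.independent_left d hd k hk⟩
  · rintro ⟨⟨hk, hk'⟩, hkD⟩
    by_contra hkn
    rcases h.exists_adj hkn hk with ⟨d, hd, hdk⟩ | ⟨u, hu, hku⟩
    · exact hkD d hd hdk
    · exact hk' u hu hku

theorem IsTight.isKernel_op {D U : Set V} (h : G.IsTight D U) :
    G.op.IsKernel {k | k ∉ D ∧ ∀ d ∈ D, ¬ G.Adj d k} U := h.op.isKernel

theorem IsTight.eq_of_left_eq [Finite V] {D U U' : Set V} (h : G.IsTight D U)
    (h' : G.IsTight D U') : U = U' := h.isKernel_op.unique h'.isKernel_op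

/-- The kernels of a down-set and of its complement form a tight pair. -/
theorem isTight_of_isKernel {X D U : Set V} (hX : ∀ a ∈ X, ∀ b, G.Adj a b → b ∈ X)
    (hD : G.IsKernel X D) (hU : G.op.IsKernel Xᶜ U) : G.IsTight D U := by
  refine isTight_of_exists_adj ⟨fun a ha b hb => hD.not_adj ha hb,
    fun a ha b hb => hU.not_adj hb ha, ?_, ?_⟩ ?_
  · exact Set.disjoint_left.2 fun a ha ha' => hU.subset ha' (hD.subset ha)
  · exact fun d hd u hu hdu => hU.subset hu (hX d (hD.subset hd) u hdu)
  · intro k hkD hkU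
    by_cases hk : k ∈ X
    · exact .inl (hD.exists_adj hk hkD)
    · exact .inr (hU.exists_adj hk hkU)

theorem IsIndependent.isTight_of_isKernel {D U : Set V} (hD : G.IsIndependent D)
    (hU : G.op.IsKernel {k | k ∉ D ∧ ∀ d ∈ D, ¬ G.Adj d k} U) : G.IsTight D U := by
  refine isTight_of_exists_adj ⟨hD, fun a ha b hb => hU.not_adj hb ha, ?_, ?_⟩ ?_
  · exact Set.disjoint_right.2 fun a ha => (hU.subset ha).1
  · exact fun d hd u hu => (hU.subset hu).2 d hd
  · intro k hkD hkU
    by_cases hk : ∃ d ∈ D, G.Adj d k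
    · exact .inl hk
    · push Not at hk
      exact .inr (hU.exists_adj ⟨hkD, hk⟩ hkU)

end Tight

/-! ### Flips as steps -/

section Step

variable {V : Type*} {G : AcyclicDigraph V} {l l' : List V}

/-- The flip at `g` sends `x` to `y`, where `g ∈ x.U`: an intrinsic description. -/
structure Step (g : V) (x y : G.Tops l l') : Prop where
  mem_U : g ∈ x.U
  mem_D : g ∈ y.D
  mem_D_iff : ∀ k, ¬ G.Le k g → (k ∈ x.D ↔ k ∈ y.D)
  mem_U_iff : ∀ k, ¬ G.Le g k → (k ∈ x.U ↔ k ∈ y.U)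

/-- The top of the opposite digraph obtained by exchanging the two components. -/
def Tops.op (x : G.Tops l l') : G.op.Tops l' l := ⟨x.U, x.D, x.tight.op⟩

theorem Step.op {g : V} {x y : G.Tops l l'} (h : Step g x y) : Step g y.op x.op :=
  ⟨h.mem_D, h.mem_U, fun k hk => (h.mem_U_iff k (mt G.op_le.2 hk)).symm,
    fun k hk => (h.mem_D_iff k (mt G.op_le.2 hk)).symm⟩

/-- By tightness, membership of `k` in `D` is determined by `U` at `k` and its out-neighbours and by
`D` above `k`. For `k < g` this part of `U` is inherited from `x`, so induction from the top
applies. -/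
theorem Step.mem_D_iff_of_forall [Finite V] {g : V} {x y z : G.Tops l l'} (h : Step g x y)
    (h' : Step g x z) (k : V) : k ∈ y.D ↔ k ∈ z.D := by
  induction k using G.wellFounded_gt.induction with
  | _ k ih =>
    by_cases hkg : G.Le k g
    · by_cases hne : k = g
      · subst hne
        exact iff_of_true h.mem_D h'.mem_D
      have hlt := hkg.lt_of_ne hne
      have hU : ∀ u, G.Le u k → (u ∈ y.U ↔ u ∈ z.U) := fun u hu => by
        have := not_le_of_lt (hu.trans_lt hlt)
        rw [← h.mem_U_iff u this, h'.mem_U_iff u this]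
      rw [y.tight.isKernel k, z.tight.isKernel k]
      refine and_congr (and_congr (not_congr (hU k (.refl k))) (forall_congr' fun u => ?_))
        (forall_congr' fun d => ?_)
      · by_cases hu : G.Adj k u
        · simp [hU u (le_of_adj hu), hu]
        · simp [hu]
      · by_cases hd : G.Adj d k
        · simp [ih d (lt_of_adj hd), hd]
        · simp [hd]
    · rw [← h.mem_D_iff k hkg, h'.mem_D_iff k hkg]

theorem Step.unique [Finite V] {g : V} {x y z : G.Tops l l'} (h : Step g x y)
    (h' : Step g x z) : y = z := by
  have hD : y.D = z.D := Set.ext (h.mem_D_iff_of_forall h')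
  refine Tops.ext hD (y.tight.eq_of_left_eq ?_)
  rw [hD]
  exact z.tight

/-- Tightness of `x` prevents the greedy passes from adding to `D` anything not below `g`, or to `U`
anything not above `g`. With `Step.unique`, flips no longer depend on how the lists are chosen. -/
theorem exists_flip_eq (hl : G.IsLinearExtension l) (hl' : G.IsReverseLinearExtension l')
    (x : G.Tops l l') {g : V} (hg : g ∈ x.U) :
    ∃ y : G.Tops l l', G.flip l l' g (x.D, x.U) = (y.D, y.U) ∧ Step g x y := by
  obtain ⟨D, U, hx⟩ := x
  simp only at hg ⊢
  rw [flip, if_pos hg]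
  simp only [complete]
  set D₀ : Set V := insert g {k ∈ D | ¬ G.Le k g} with hD₀
  set U₀ : Set V := {k ∈ U | ¬ G.Le g k} with hU₀
  have hD1 := mem_greedy_iff (A := fun k => ¬ G.Le g k ∧ k ∉ U₀ ∧ (∀ i ∈ U₀, ¬ G.Adj k i))
    hl'.pairwise not_adj_self D₀
  simp only [hl'.mem, true_and, and_assoc] at hD1
  set D₁ := greedy (fun k T => ¬ G.Le g k ∧ k ∉ U₀ ∧ (∀ i ∈ U₀, ¬ G.Adj k i) ∧
    ∀ i ∈ T, ¬ G.Adj i k) l' D₀ with hD₁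
  have hU1 := mem_greedy_iff (A := fun k => ¬ G.Le k g ∧ k ∉ D₁ ∧ (∀ i ∈ D₁, ¬ G.Adj i k))
    (B := fun i k => G.Adj k i) hl.pairwise not_adj_self U₀
  simp only [hl.mem, true_and, and_assoc] at hU1
  set U₁ := greedy (fun k T => ¬ G.Le k g ∧ k ∉ D₁ ∧ (∀ i ∈ D₁, ¬ G.Adj i k) ∧
    ∀ i ∈ T, ¬ G.Adj k i) l U₀ with hU₁
  clear_value D₁ U₁
  have ho := hx.orthogonal
  have hdisj : ∀ k, k ∈ D → k ∉ U := fun k => fun h => Set.disjoint_left.1 ho.disjoint h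
  have hgD : g ∉ D := fun h => hdisj g h hg
  have hgD₁ : g ∈ D₁ := (hD1 g).2 (.inl (.inl rfl))
  -- new elements of the first component lie below `g`
  have hDD : ∀ k, ¬ G.Le k g → (k ∈ D ↔ k ∈ D₁) := by
    intro k hk
    refine ⟨fun h => (hD1 k).2 (.inl (.inr ⟨h, hk⟩)), fun h => ?_⟩
    rcases (hD1 k).1 h with (rfl | h) | ⟨hgk, hkU, hkU', hkD⟩
    · exact absurd (.refl _) hk
    · exact h.1
    · by_contra hkD'
      rcases hx.exists_adj hkD' (fun h => hkU ⟨h, hgk⟩) with ⟨d, hd, hdk⟩ | ⟨u, hu, hku⟩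
      · refine hkD d ((hD1 d).2 (.inl (.inr ⟨hd, fun hdg => ?_⟩))) hdk
        exact hk ((le_of_adj hdk).trans hdg)
      · exact hkU' u ⟨hu, fun hgu => hgk (hgu.trans (le_of_adj hku))⟩ hku
  have hgU₁ : g ∉ U₁ := fun h => by
    rcases (hU1 g).1 h with h | h
    · exact h.2 (.refl g)
    · exact h.1 (.refl g)
  -- new elements of the second component lie above `g`
  have hUU : ∀ k, ¬ G.Le g k → (k ∈ U ↔ k ∈ U₁) := by
    intro k hk
    refine ⟨fun h => (hU1 k).2 (.inl ⟨h, hk⟩), fun h => ?_⟩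
    rcases (hU1 k).1 h with h | ⟨hkg, hkD, hkD', hkU⟩
    · exact h.1
    · by_contra hkU'
      rcases hx.exists_adj (fun h => hkD ((hDD k hkg).1 h)) hkU' with ⟨d, hd, hdk⟩ | ⟨u, hu, hku⟩
      · by_cases hdg : G.Le d g
        · exact hkg ((le_of_adj hdk).trans hdg)
        · exact hkD' d ((hDD d hdg).1 hd) hdk
      · exact hkU u ((hU1 u).2 (.inl ⟨hu, fun hgu => hk (hgu.trans (le_of_adj hku))⟩)) hku
  have hD₀U₀ : ∀ d ∈ D₀, ∀ u ∈ U₀, ¬ G.Adj d u := by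
    rintro d (rfl | hd) u hu
    · exact ho.independent_right _ hg u hu.1
    · exact ho.not_adj d hd.1 u hu.1
  have hD₁U₀ : ∀ d ∈ D₁, ∀ u ∈ U₀, ¬ G.Adj d u := fun d hd => by
    rcases (hD1 d).1 hd with h | h
    · exact hD₀U₀ d h
    · exact h.2.2.1
  have hdisj' : ∀ k ∈ D₁, k ∉ U₀ := fun k hk hkU => by
    rcases (hD1 k).1 hk with (rfl | h) | h
    · exact hkU.2 (.refl _)
    · exact hdisj k h.1 hkU.1
    · exact h.2.1 hkU
  have hlt : ∀ k ∈ D₁, G.Le k g ∨ k ∈ D ∧ ¬ G.Le k g := fun k hk => by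
    by_cases h : G.Le k g
    · exact .inl h
    · exact .inr ⟨(hDD k h).2 hk, h⟩
  have hltU : ∀ k ∈ U₁, G.Lt g k ∨ k ∈ U ∧ ¬ G.Le g k := fun k hk => by
    by_cases h : G.Le g k
    · refine .inl (h.lt_of_ne ?_)
      rintro rfl
      exact hgU₁ hk
    · exact .inr ⟨(hUU k h).2 hk, h⟩
  have horth : G.IsOrthogonal D₁ U₁ := by
    refine ⟨?_, ?_, ?_, ?_⟩
    · intro a ha b hb hab
      rcases (hD1 b).1 hb with h | h
      · rcases hlt a ha with ha' | ha'
        · rcases h with rfl | h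
          · exact not_le_of_lt (lt_of_adj hab) ha'
          · exact h.2 ((le_of_adj hab).trans ha')
        · rcases h with rfl | h
          · exact ho.not_adj a ha'.1 _ hg hab
          · exact ho.independent_left a ha'.1 b h.1 hab
      · exact h.2.2.2 a ha hab
    · intro a ha b hb hab
      rcases (hU1 a).1 ha with h | h
      · rcases hltU b hb with hb' | hb'
        · exact h.2 (hb'.le.trans (le_of_adj hab))
        · exact ho.independent_right a h.1 b hb'.1 hab
      · exact h.2.2.2 b hb hab
    · refine Set.disjoint_left.2 fun k hk hk' => ?_
      rcases (hU1 k).1 hk' with h | h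
      · exact hdisj' k hk h
      · exact h.2.1 hk
    · intro d hd u hu
      rcases (hU1 u).1 hu with h | h
      · exact hD₁U₀ d hd u h
      · exact h.2.2.1 d hd
  refine ⟨⟨D₁, U₁, isTight_of_exists_adj horth ?_⟩, rfl, hg, hgD₁, hDD, hUU⟩
  intro k hkD hkU
  by_contra! hc
  -- An unjoined vertex outside both sets would have been accepted by the first pass if it is below
  -- `g`, and by the second pass otherwise.
  by_cases hkg : G.Le k g
  · have hgk : ¬ G.Le g k := fun h => hkD ((h.antisymm hkg) ▸ hgD₁)
    refine hkD ((hD1 k).2 (.inr ⟨hgk, fun h => hkU ((hU1 k).2 (.inl h)), fun i hi => ?_, hc.1⟩))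
    exact hc.2 i ((hU1 i).2 (.inl hi))
  · exact hkU ((hU1 k).2 (.inr ⟨hkg, hkD, hc.1, hc.2⟩))

theorem upFlip_iff [Finite V] (hl : G.IsLinearExtension l) (hl' : G.IsReverseLinearExtension l')
    {x y : G.Tops l l'} : Tops.UpFlip x y ↔ ∃ g, Step g x y := by
  constructor
  · rintro ⟨g, hg, h⟩
    obtain ⟨z, hz, hs⟩ := exists_flip_eq hl hl' x hg
    refine ⟨g, ?_⟩
    have : y = z := by
      rw [h] at hz
      exact Tops.ext (congrArg Prod.fst hz) (congrArg Prod.snd hz)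
    exact this ▸ hs
  · rintro ⟨g, h⟩
    obtain ⟨z, hz, hs⟩ := exists_flip_eq hl hl' x h.mem_U
    obtain rfl := h.unique hs
    exact ⟨g, h.mem_U, hz⟩

theorem Tops.notMem_D {x : G.Tops l l'} {g : V} (h : g ∈ x.U) : g ∉ x.D :=
  Set.disjoint_right.1 x.tight.orthogonal.disjoint h

theorem Tops.notMem_U {x : G.Tops l l'} {g : V} (h : g ∈ x.D) : g ∉ x.U :=
  Set.disjoint_left.1 x.tight.orthogonal.disjoint h

theorem exists_step_up (hl : G.IsLinearExtension l) (hl' : G.IsReverseLinearExtension l')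
    {x : G.Tops l l'} {g : V} (hg : g ∈ x.U) : ∃ y, Step g x y :=
  (exists_flip_eq hl hl' x hg).imp fun _ h => h.2

theorem exists_step_down (hl : G.IsLinearExtension l) (hl' : G.IsReverseLinearExtension l')
    {y : G.Tops l l'} {g : V} (hg : g ∈ y.D) : ∃ x, Step g x y := by
  obtain ⟨z, hz⟩ := exists_step_up hl'.op hl.op (x := y.op) hg
  exact ⟨z.op, hz.op⟩

theorem IsIndependent.exists_tops (hl : G.IsLinearExtension l) {D : Set V}
    (hD : G.IsIndependent D) : ∃ x : G.Tops l l', x.D = D := by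
  obtain ⟨U, hU⟩ := hl.op.exists_isKernel {k | k ∉ D ∧ ∀ d ∈ D, ¬ G.Adj d k}
  exact ⟨⟨D, U, hD.isTight_of_isKernel hU⟩, rfl⟩

theorem isIndependent_singleton (g : V) : G.IsIndependent {g} := by
  rintro _ rfl _ rfl
  exact not_adj_self _

theorem exists_D_eq_singleton (hl : G.IsLinearExtension l) (g : V) :
    ∃ x : G.Tops l l', x.D = {g} := (isIndependent_singleton g).exists_tops hl

theorem exists_U_eq_singleton (hl' : G.IsReverseLinearExtension l') (g : V) :
    ∃ x : G.Tops l l', x.U = {g} := by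
  obtain ⟨x, hx⟩ := exists_D_eq_singleton (G := G.op) (l' := l) hl'.op g
  exact ⟨x.op, hx⟩

theorem exists_tops_of_downset (hl : G.IsLinearExtension l) (hl' : G.IsReverseLinearExtension l')
    {X : Set V} (hX : ∀ a ∈ X, ∀ b, G.Adj a b → b ∈ X) :
    ∃ x : G.Tops l l', G.IsKernel X x.D ∧ G.op.IsKernel Xᶜ x.U := by
  obtain ⟨D, hD⟩ := hl'.exists_isKernel X
  obtain ⟨U, hU⟩ := hl.op.exists_isKernel Xᶜ
  exact ⟨⟨D, U, isTight_of_isKernel hX hD hU⟩, hD, hU⟩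

theorem downset_adj (g a : V) (ha : G.Le a g) (b : V) (hab : G.Adj a b) : G.Le b g :=
  (le_of_adj hab).trans ha

end Step

/-! ### The order on tops -/

section TopsOrder

variable {V : Type*} [Finite V] {G : AcyclicDigraph V} {l l' : List V}

instance : Finite (G.Tops l l') :=
  Finite.of_injective (fun x => (x.D, x.U)) fun _ _ h =>
    Tops.ext (congrArg Prod.fst h) (congrArg Prod.snd h)

theorem Tops.ext_D {x y : G.Tops l l'} (h : x.D = y.D) : x = y := by
  refine Tops.ext h (x.tight.eq_of_left_eq ?_)
  rw [h]
  exact y.tight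

theorem Step.lt (hl : G.IsLinearExtension l) (hl' : G.IsReverseLinearExtension l') {g : V}
    {x y : G.Tops l l'} (h : Step g x y) : x < y := by
  refine lt_of_le_of_ne (Relation.ReflTransGen.single ((upFlip_iff hl hl').2 ⟨g, h⟩)) ?_
  rintro rfl
  exact Tops.notMem_D h.mem_U h.mem_D

theorem exists_step_of_lt (hl : G.IsLinearExtension l) (hl' : G.IsReverseLinearExtension l')
    {x y : G.Tops l l'} (h : x < y) : ∃ g z, Step g x z ∧ z ≤ y := by
  rcases Relation.ReflTransGen.cases_head h.le with rfl | ⟨z, hxz, hzy⟩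
  · exact absurd h (lt_irrefl _)
  · obtain ⟨g, hg⟩ := (upFlip_iff hl hl').1 hxz
    exact ⟨g, z, hg, hzy⟩

/-- Induction along the steps between two comparable tops. -/
theorem Tops.le_induction (hl : G.IsLinearExtension l) (hl' : G.IsReverseLinearExtension l')
    {x y : G.Tops l l'} (h : x ≤ y) {P : G.Tops l l' → Prop} (hx : P x)
    (hP : ∀ g a b, x ≤ a → Step g a b → b ≤ y → P a → P b) : P y := by
  have : ∀ z, Relation.ReflTransGen Tops.UpFlip x z → z ≤ y → P z := by
    intro z hz
    induction hz with
    | refl => exact fun _ => hx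
    | @tail a b hxa hab ih =>
      intro hby
      obtain ⟨g, hg⟩ := (upFlip_iff hl hl').1 hab
      exact hP g a b hxa hg hby (ih ((hg.lt hl hl').le.trans hby))
  exact this y h le_rfl

theorem Tops.op_le_op (hl : G.IsLinearExtension l) (hl' : G.IsReverseLinearExtension l')
    {x y : G.Tops l l'} (h : x ≤ y) : y.op ≤ x.op :=
  Tops.le_induction hl hl' h (P := fun z => z.op ≤ x.op) le_rfl
    fun _ _ _ _ hab _ h => (hab.op.lt hl'.op hl.op).le.trans h

/-! ### Labels along chains of flips; every step is a cover relation -/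

theorem mem_D_of_le (hl : G.IsLinearExtension l) (hl' : G.IsReverseLinearExtension l')
    {x y : G.Tops l l'} (h : x ≤ y) {g : V} (hg : g ∈ x.D)
    (hk : ∀ k a b, x ≤ a → Step k a b → b ≤ y → ¬ G.Lt g k) : g ∈ y.D := by
  refine Tops.le_induction hl hl' h (P := fun z => g ∈ z.D) hg fun k a b hxa hab hby ha => ?_
  refine (hab.mem_D_iff g fun hgk => ?_).1 ha
  refine hk k a b hxa hab hby (hgk.lt_of_ne ?_)
  rintro rfl
  exact Tops.notMem_D hab.mem_U ha

theorem mem_U_of_le (hl : G.IsLinearExtension l) (hl' : G.IsReverseLinearExtension l')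
    {x y : G.Tops l l'} (h : x ≤ y) {g : V} (hg : g ∈ x.U)
    (hk : ∀ k a b, x ≤ a → Step k a b → b ≤ y → ¬ G.Le k g) : g ∈ y.U :=
  Tops.le_induction hl hl' h (P := fun z => g ∈ z.U) hg fun k a b hxa hab hby ha =>
    (hab.mem_U_iff g (hk k a b hxa hab hby)).1 ha

/-- The flips between the ends of a step have labels below the label of this step. -/
theorem Step.label_le (hl : G.IsLinearExtension l) (hl' : G.IsReverseLinearExtension l')
    {g k : V} {x a b y : G.Tops l l'} (h : Step g x y) (hxa : x ≤ a) (hab : Step k a b)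
    (hby : b ≤ y) : G.Le k g := by
  -- Take a maximal label `k` among those not below `g`. Then `k ∈ b.D` persists up to `y`,
  -- transfers to `x` across the step, and persists up to `a`, although `k ∈ a.U`.
  by_contra hkg
  induction k using G.wellFounded_gt.induction generalizing a b with
  | _ k ih =>
    have hmax : ∀ k' a b, x ≤ a → Step k' a b → b ≤ y → ¬ G.Lt k k' := fun k' a b h1 h2 h3 h4 =>
      ih k' h4 h1 h2 h3 fun h5 => hkg (h4.le.trans h5)
    have hlt := hab.lt hl hl'
    have hy := mem_D_of_le hl hl' hby hab.mem_D fun k' a' b' h1 h2 h3 =>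
      hmax k' a' b' (hxa.trans (hlt.le.trans h1)) h2 h3
    have ha := mem_D_of_le hl hl' hxa ((h.mem_D_iff k hkg).2 hy) fun k' a' b' h1 h2 h3 =>
      hmax k' a' b' h1 h2 (h3.trans (hlt.le.trans hby))
    exact Tops.notMem_U ha hab.mem_U

theorem Step.label_eq (hl : G.IsLinearExtension l) (hl' : G.IsReverseLinearExtension l')
    {g k : V} {x a b y : G.Tops l l'} (h : Step g x y) (hxa : x ≤ a) (hab : Step k a b)
    (hby : b ≤ y) : k = g :=
  (h.label_le hl hl' hxa hab hby).antisymm <| G.op_le.1 <|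
    h.op.label_le hl'.op hl.op (Tops.op_le_op hl hl' hby) hab.op (Tops.op_le_op hl hl' hxa)

/-- An element strictly between would give two consecutive upward flips with the same label `g`, but
the first one puts `g` into `D`. -/
theorem Step.covBy (hl : G.IsLinearExtension l) (hl' : G.IsReverseLinearExtension l') {g : V}
    {x y : G.Tops l l'} (h : Step g x y) : x ⋖ y := by
  refine ⟨h.lt hl hl', fun z hxz hzy => ?_⟩
  obtain ⟨k, b, hxb, hbz⟩ := exists_step_of_lt hl hl' hxz
  obtain rfl := h.label_eq hl hl' le_rfl hxb (hbz.trans hzy.le)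
  obtain ⟨k', c, hbc, hcy⟩ := exists_step_of_lt hl hl' (hbz.trans_lt hzy)
  obtain rfl := h.label_eq hl hl' (hxb.lt hl hl').le hbc hcy
  exact Tops.notMem_U hxb.mem_D hbc.mem_U

/-! ### Join and meet labels of tops -/

/-- The vertices `g` such that `x` is above the top with first component `{g}`. -/
def joinLabels (x : G.Tops l l') : Set V := {g | ∃ j : G.Tops l l', j.D = {g} ∧ j ≤ x}

/-- The vertices `g` such that `x` is below the top with second component `{g}`. -/
def meetLabels (x : G.Tops l l') : Set V := {g | ∃ m : G.Tops l l', m.U = {g} ∧ x ≤ m}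

theorem joinLabels_mono {x y : G.Tops l l'} (h : x ≤ y) : joinLabels x ⊆ joinLabels y :=
  fun _ ⟨j, hj, hjx⟩ => ⟨j, hj, hjx.trans h⟩

theorem meetLabels_anti {x y : G.Tops l l'} (h : x ≤ y) : meetLabels y ⊆ meetLabels x :=
  fun _ ⟨j, hj, hjx⟩ => ⟨j, hj, h.trans hjx⟩

theorem le_of_mem_joinLabels {x j : G.Tops l l'} {g : V} (hg : g ∈ joinLabels x)
    (hj : j.D = {g}) : j ≤ x := by
  obtain ⟨i, hi, hix⟩ := hg
  rwa [Tops.ext_D (hj.trans hi.symm)]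

theorem joinLabels_op (hl : G.IsLinearExtension l) (hl' : G.IsReverseLinearExtension l')
    (x : G.Tops l l') : joinLabels x.op = meetLabels x := by
  ext g
  constructor
  · rintro ⟨j, hj, hjx⟩
    exact ⟨j.op, hj, Tops.op_le_op hl'.op hl.op hjx⟩
  · rintro ⟨j, hj, hjx⟩
    exact ⟨j.op, hj, Tops.op_le_op hl hl' hjx⟩

theorem le_of_mem_meetLabels (hl : G.IsLinearExtension l) (hl' : G.IsReverseLinearExtension l')
    {x m : G.Tops l l'} {g : V} (hg : g ∈ meetLabels x) (hm : m.U = {g}) : x ≤ m := by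
  rw [← joinLabels_op hl hl'] at hg
  exact Tops.op_le_op hl'.op hl.op (le_of_mem_joinLabels (j := m.op) hg hm)

/-- Flip downwards, keeping the hypothesis on `g`, until `D = {g}`. If `g ∈ D`, flip another element
of `D`; if not, flip some `d ∈ D` with an edge to `g`. -/
theorem mem_joinLabels_of_not_adj (hl : G.IsLinearExtension l)
    (hl' : G.IsReverseLinearExtension l') {x : G.Tops l l'} {g : V} (hg : g ∉ x.U)
    (hg' : ∀ u ∈ x.U, ¬ G.Adj g u) : g ∈ joinLabels x := by
  induction x using WellFoundedLT.induction with
  | _ x ih =>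
    by_cases hx : x.D = {g}
    · exact ⟨x, hx, le_rfl⟩
    -- If `h` is not below `g`, the flip does not change `U` at `g` or at its out-neighbours. If `g`
    -- is in the lower `D`, orthogonality gives the hypothesis again.
    have key : ∀ h y, Step h y x → (¬ G.Le h g ∨ g ∈ y.D) → g ∈ joinLabels x := by
      intro h y hy hh
      refine joinLabels_mono (hy.lt hl hl').le (ih y (hy.lt hl hl') ?_ ?_)
      · rcases hh with hh | hh
        · rwa [hy.mem_U_iff g hh]
        · exact Tops.notMem_U hh
      · rcases hh with hh | hh
        · intro u hu hgu
          refine hg' u ((hy.mem_U_iff u fun h' => hh (h'.trans (le_of_adj hgu))).1 hu) hgu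
        · exact y.tight.orthogonal.not_adj g hh
    by_cases hgD : g ∈ x.D
    · have : ∃ h ∈ x.D, h ≠ g := by
        by_contra! hc
        exact hx (Set.eq_singleton_iff_unique_mem.2 ⟨hgD, hc⟩)
      obtain ⟨h, hh, hne⟩ := this
      obtain ⟨y, hy⟩ := exists_step_down hl hl' hh
      refine key h y hy ?_
      by_cases hle : G.Le h g
      · exact .inr ((hy.mem_D_iff g (not_le_of_lt (hle.lt_of_ne hne))).2 hgD)
      · exact .inl hle
    · obtain ⟨d, hd, hdg⟩ := x.tight.isKernel.exists_adj ⟨hg, hg'⟩ hgD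
      obtain ⟨y, hy⟩ := exists_step_down hl hl' hd
      exact key d y hy (.inl (not_le_of_lt (lt_of_adj hdg)))

theorem mem_joinLabels_of_mem (hl : G.IsLinearExtension l)
    (hl' : G.IsReverseLinearExtension l') {x : G.Tops l l'} {g : V} (hg : g ∈ x.D) :
    g ∈ joinLabels x :=
  mem_joinLabels_of_not_adj hl hl' (Tops.notMem_U hg) (x.tight.orthogonal.not_adj g hg)

theorem mem_meetLabels_of_not_adj (hl : G.IsLinearExtension l)
    (hl' : G.IsReverseLinearExtension l') {x : G.Tops l l'} {g : V} (hg : g ∉ x.D)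
    (hg' : ∀ d ∈ x.D, ¬ G.Adj d g) : g ∈ meetLabels x := by
  rw [← joinLabels_op hl hl']
  exact mem_joinLabels_of_not_adj hl'.op hl.op (x := x.op) hg hg'

theorem mem_meetLabels_of_mem (hl : G.IsLinearExtension l)
    (hl' : G.IsReverseLinearExtension l') {x : G.Tops l l'} {g : V} (hg : g ∈ x.U) :
    g ∈ meetLabels x :=
  mem_meetLabels_of_not_adj hl hl' (Tops.notMem_D hg) fun d hd =>
    x.tight.orthogonal.not_adj d hd g hg

theorem Tops.le_of_D_eq_empty (hl : G.IsLinearExtension l) (hl' : G.IsReverseLinearExtension l')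
    {x y : G.Tops l l'} (h : x.D = ∅) : x ≤ y := by
  induction y using WellFoundedLT.induction with
  | _ y ih =>
    rcases y.D.eq_empty_or_nonempty with h' | ⟨g, hg⟩
    · rw [Tops.ext_D (h.trans h'.symm)]
    · obtain ⟨z, hz⟩ := exists_step_down hl hl' hg
      exact (ih z (hz.lt hl hl')).trans (hz.lt hl hl').le

/-! ### Independence posets which are lattices -/

theorem isLatticePoset_op (hl : G.IsLinearExtension l) (hl' : G.IsReverseLinearExtension l')
    (h : IsLatticePoset (G.Tops l l')) : IsLatticePoset (G.op.Tops l' l) := by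
  have hle : ∀ {x y : G.op.Tops l' l}, x ≤ y → y.op ≤ x.op := Tops.op_le_op hl'.op hl.op
  have hle' : ∀ {x y : G.Tops l l'}, x ≤ y → y.op ≤ x.op := Tops.op_le_op hl hl'
  intro x y
  obtain ⟨⟨a, ha⟩, b, hb⟩ := h x.op y.op
  refine ⟨⟨b.op, ?_, fun z hz => ?_⟩, a.op, ?_, fun z hz => ?_⟩
  · rintro z (rfl | rfl)
    · exact hle' (x := b) (y := z.op) (hb.1 (.inl rfl))
    · exact hle' (x := b) (y := z.op) (hb.1 (.inr rfl))
  · refine hle' (x := z.op) (y := b) (hb.2 ?_)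
    rintro w (rfl | rfl)
    · exact hle (hz (.inl rfl))
    · exact hle (hz (.inr rfl))
  · rintro z (rfl | rfl)
    · exact hle' (y := a) (x := z.op) (ha.1 (.inl rfl))
    · exact hle' (y := a) (x := z.op) (ha.1 (.inr rfl))
  · refine hle' (y := z.op) (x := a) (ha.2 ?_)
    rintro w (rfl | rfl)
    · exact hle (hz (.inl rfl))
    · exact hle (hz (.inr rfl))

/-- If `x.D` has two elements, flipping them down gives two distinct elements covered by `x`, whose
join must be `x`; induction handles both. The lattice hypothesis is what makes a top determined by
the `j_g` below it. -/
theorem le_of_joinLabels_subset (hl : G.IsLinearExtension l)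
    (hl' : G.IsReverseLinearExtension l') (hL : IsLatticePoset (G.Tops l l'))
    {x y : G.Tops l l'} (h : joinLabels x ⊆ joinLabels y) : x ≤ y := by
  induction x using WellFoundedLT.induction with
  | _ x ih =>
    rcases x.D.eq_empty_or_nonempty with h' | ⟨g, hg⟩
    · exact Tops.le_of_D_eq_empty hl hl' h'
    by_cases hx : x.D = {g}
    · exact le_of_mem_joinLabels (h ⟨x, hx, le_rfl⟩) hx
    have : ∃ h ∈ x.D, h ≠ g := by
      by_contra! hc
      exact hx (Set.eq_singleton_iff_unique_mem.2 ⟨hg, hc⟩)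
    obtain ⟨k, hk, hne⟩ := this
    obtain ⟨a, ha⟩ := exists_step_down hl hl' hg
    obtain ⟨b, hb⟩ := exists_step_down hl hl' hk
    have ha' := ha.lt hl hl'
    have hb' := hb.lt hl hl'
    have hay := ih a ha' ((joinLabels_mono ha'.le).trans h)
    have hby := ih b hb' ((joinLabels_mono hb'.le).trans h)
    obtain ⟨⟨s, hs⟩, -⟩ := hL a b
    have hsy : s ≤ y := hs.2 (by rintro z (rfl | rfl) <;> assumption)
    have hsx : s ≤ x := hs.2 (by rintro z (rfl | rfl) <;> exact le_of_lt ‹_›)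
    have has : a ≤ s := hs.1 (.inl rfl)
    rcases hsx.eq_or_lt with rfl | hsx
    · exact hsy
    · obtain rfl : a = s := has.eq_of_not_lt fun h => (ha.covBy hl hl').2 h hsx
      have hba : b ≤ a := hs.1 (.inr rfl)
      obtain rfl : b = a := hba.eq_of_not_lt fun h => (hb.covBy hl hl').2 h hsx
      exact absurd (ha.label_eq hl hl' le_rfl hb le_rfl) hne

theorem subset_joinLabels (hl : G.IsLinearExtension l) (hl' : G.IsReverseLinearExtension l')
    {X : Set V} (hX : ∀ a ∈ X, ∀ b, G.Adj a b → b ∈ X) {x : G.Tops l l'}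
    (hU : G.op.IsKernel Xᶜ x.U) : X ⊆ joinLabels x := fun g hg =>
  mem_joinLabels_of_not_adj hl hl' (fun h => hU.subset h hg)
    fun u hu hgu => hU.subset hu (hX g hg u hgu)

/-- Adding to a down-set a minimal vertex of its complement corresponds to a step. -/
theorem step_of_isKernel {X X' : Set V} {g : V} {x y : G.Tops l l'} (hg : g ∉ X)
    (hX' : X' = insert g X) (hX : ∀ a ∈ X, ∀ b, G.Adj a b → b ∈ X)
    (hgX : ∀ b, G.Adj g b → b ∈ X) (hxD : G.IsKernel X x.D) (hxU : G.op.IsKernel Xᶜ x.U)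
    (hyD : G.IsKernel X' y.D) (hyU : G.op.IsKernel X'ᶜ y.U) : Step g x y := by
  subst hX'
  refine ⟨(hxU g).2 ⟨hg, fun u hu hgu => hxU.subset hu (hgX u hgu)⟩,
    (hyD g).2 ⟨.inl rfl, fun d hd hdg => ?_⟩, fun k hk => ?_, fun k hk => ?_⟩
  · rcases hyD.subset hd with rfl | hd
    · exact not_adj_self _ hdg
    · exact hg (hX d hd g hdg)
  · refine hxD.mem_iff_of_not_le hyD (fun i hi => ?_) hk
    have : i ≠ g := by
      rintro rfl
      exact hi (.refl _)
    simp [this]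
  · refine hxU.mem_iff_of_not_le hyU (g := g) (fun i hi => ?_) (mt G.op_le.1 hk)
    have : i ≠ g := by
      rintro rfl
      exact hi (.refl _)
    simp [this]

/-- A counting argument. Adding minimal missing vertices one at a time gives a chain of steps up to
the full vertex set, and `joinLabels` grows strictly at each of them. Having at most `|V|` elements
at the end, it has at most `|X|` at the start. -/
theorem joinLabels_eq (hl : G.IsLinearExtension l) (hl' : G.IsReverseLinearExtension l')
    (hL : IsLatticePoset (G.Tops l l')) {X : Set V} (hX : ∀ a ∈ X, ∀ b, G.Adj a b → b ∈ X)
    {x : G.Tops l l'} (hD : G.IsKernel X x.D) (hU : G.op.IsKernel Xᶜ x.U) :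
    joinLabels x = X := by
  refine (Set.eq_of_subset_of_ncard_le (subset_joinLabels hl hl' hX hU) ?_).symm
  induction X using WellFoundedGT.induction generalizing x with
  | _ X ih =>
    rcases (Xᶜ).eq_empty_or_nonempty with h | hne
    · rw [Set.compl_empty_iff] at h
      subst h
      exact Set.ncard_le_ncard (Set.subset_univ _)
    · have hg := WellFounded.min_mem G.wellFounded_lt _ hne
      have hmin := fun v => WellFounded.not_lt_min G.wellFounded_lt (x := v) (Xᶜ)
      set g := G.wellFounded_lt.min Xᶜ hne
      have hgX : ∀ b, G.Adj g b → b ∈ X := fun b hb => by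
        by_contra hbX
        exact hmin b hbX (lt_of_adj hb)
      have hX' : ∀ a ∈ insert g X, ∀ b, G.Adj a b → b ∈ insert g X := by
        rintro a (rfl | ha) b hab
        · exact .inr (hgX b hab)
        · exact .inr (hX a ha b hab)
      obtain ⟨y, hyD, hyU⟩ := exists_tops_of_downset (l := l) (l' := l') hl hl' hX'
      have hs : Step g x y := step_of_isKernel hg rfl hX hgX hD hU hyD hyU
      have h1 := ih (insert g X) (Set.ssubset_insert hg) hX' hyD hyU
      rw [Set.ncard_insert_of_notMem hg] at h1
      have h2 : joinLabels x ⊂ joinLabels y := by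
        refine (joinLabels_mono (hs.lt hl hl').le).ssubset_of_not_subset fun h => ?_
        exact (hs.lt hl hl').not_ge (le_of_joinLabels_subset hl hl' hL h)
      have h3 := Set.ncard_lt_ncard h2
      omega

theorem meetLabels_eq (hl : G.IsLinearExtension l) (hl' : G.IsReverseLinearExtension l')
    (hL : IsLatticePoset (G.Tops l l')) {X : Set V} (hX : ∀ a ∈ X, ∀ b, G.Adj a b → b ∈ X)
    {x : G.Tops l l'} (hD : G.IsKernel X x.D) (hU : G.op.IsKernel Xᶜ x.U) :
    meetLabels x = Xᶜ := by
  rw [← joinLabels_op hl hl']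
  refine joinLabels_eq hl'.op hl.op (isLatticePoset_op hl hl' hL) ?_ hU ?_
  · exact fun a ha b hb hbX => ha (hX b hbX a hb)
  · rw [compl_compl]
    exact hD

/-- Let `x ⋖ y` come from the down-sets strictly below `g` and below `g`. If `j ≤ m`, the join of
`x` and `j` lies below both `y` and `m`, so it is `x` or `y`. Then `g` is a join label of `x` or a
meet label of `y`, and the down-sets exclude both. -/
theorem not_le_of_D_eq_of_U_eq (hl : G.IsLinearExtension l)
    (hl' : G.IsReverseLinearExtension l') (hL : IsLatticePoset (G.Tops l l')) {g : V}
    {j m : G.Tops l l'} (hj : j.D = {g}) (hm : m.U = {g}) : ¬ j ≤ m := by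
  intro hjm
  have hX : ∀ a ∈ {k | G.Le k g}, ∀ b, G.Adj a b → b ∈ {k | G.Le k g} := downset_adj g
  have hX' : ∀ a ∈ {k | G.Lt k g}, ∀ b, G.Adj a b → b ∈ {k | G.Lt k g} :=
    fun a ha b hab => (lt_of_adj hab).trans ha
  obtain ⟨y, hyD, hyU⟩ := exists_tops_of_downset (l := l) (l' := l') hl hl' hX
  obtain ⟨x, hxD, hxU⟩ := exists_tops_of_downset (l := l) (l' := l') hl hl' hX'
  have hs : Step g x y := by
    refine step_of_isKernel (G.acyclic g) ?_ hX' (fun b hb => lt_of_adj hb) hxD hxU hyD hyU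
    ext k
    constructor
    · intro hk
      by_cases h : k = g
      · exact .inl h
      · exact .inr (Le.lt_of_ne hk h)
    · rintro (rfl | hk)
      · exact .refl _
      · exact Lt.le hk
  have hxy := hs.lt hl hl'
  have hjy : j ≤ y := le_of_mem_joinLabels (mem_joinLabels_of_mem hl hl' hs.mem_D) hj
  have hxm : x ≤ m := le_of_mem_meetLabels hl hl' (mem_meetLabels_of_mem hl hl' hs.mem_U) hm
  obtain ⟨⟨s, hs'⟩, -⟩ := hL x j
  have hsm : s ≤ m := hs'.2 (by rintro z (rfl | rfl) <;> assumption)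
  have hsy : s ≤ y := hs'.2 (by rintro z (rfl | rfl) <;> first | exact hxy.le | assumption)
  have hxs : x ≤ s := hs'.1 (.inl rfl)
  have hjs : j ≤ s := hs'.1 (.inr rfl)
  rcases hsy.eq_or_lt with rfl | hsy
  · have : g ∈ meetLabels s := ⟨m, hm, hsm⟩
    rw [meetLabels_eq hl hl' hL hX hyD hyU] at this
    exact this (.refl g)
  · obtain rfl : x = s := hxs.eq_of_not_lt fun h => (hs.covBy hl hl').2 h hsy
    have : g ∈ joinLabels x := ⟨j, hj, hjs⟩
    rw [joinLabels_eq hl hl' hL hX' hxD hxU] at this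
    exact G.acyclic g this

/-- Let `y` come from the vertices below `g`, and `x` from those among them not above `h`. If `j ≤
m`, the meet `z` of `m` and `y` is above `x` and `j`. Labels of steps below `z` are at most `g`, so
`g` survives from `j.D` to `z.D`; and `h` survives from `x.U` to `z.U`. The edge from `g` to `h`
contradicts orthogonality of `z`. -/
theorem not_le_of_adj (hl : G.IsLinearExtension l) (hl' : G.IsReverseLinearExtension l')
    (hL : IsLatticePoset (G.Tops l l')) {g h : V} (hgh : G.Adj g h) {j m : G.Tops l l'}
    (hj : j.D = {g}) (hm : m.U = {h}) : ¬ j ≤ m := by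
  intro hjm
  have hY : ∀ a ∈ {k | G.Le k g}, ∀ b, G.Adj a b → b ∈ {k | G.Le k g} := downset_adj g
  have hX : ∀ a ∈ {k | G.Le k g ∧ ¬ G.Le h k}, ∀ b, G.Adj a b →
      b ∈ {k | G.Le k g ∧ ¬ G.Le h k} :=
    fun a ha b hab => ⟨downset_adj g a ha.1 b hab, fun hb => ha.2 (hb.trans (le_of_adj hab))⟩
  obtain ⟨y, hyD, hyU⟩ := exists_tops_of_downset (l := l) (l' := l') hl hl' hY
  obtain ⟨x, hxD, hxU⟩ := exists_tops_of_downset (l := l) (l' := l') hl hl' hX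
  have hJy := joinLabels_eq hl hl' hL hY hyD hyU
  have hJx := joinLabels_eq hl hl' hL hX hxD hxU
  have hMx := meetLabels_eq hl hl' hL hX hxD hxU
  obtain ⟨-, z, hz⟩ := hL m y
  have hxz : x ≤ z := by
    refine hz.2 ?_
    rintro w (rfl | rfl)
    · refine le_of_mem_meetLabels hl hl' ?_ hm
      rw [hMx]
      exact fun hh => hh.2 (.refl h)
    · refine le_of_joinLabels_subset hl hl' hL ?_
      rw [hJx, hJy]
      exact fun k hk => hk.1
  have hjz : j ≤ z := by
    refine hz.2 ?_
    rintro w (rfl | rfl)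
    · exact hjm
    · refine le_of_mem_joinLabels ?_ hj
      rw [hJy]
      exact Le.refl g
  have hzm : z ≤ m := hz.1 (.inl rfl)
  have hzy : z ≤ y := hz.1 (.inr rfl)
  have hlab : ∀ k a b, Step k a b → b ≤ z → G.Le k g := fun k a b hab hbz => by
    have := joinLabels_mono (hbz.trans hzy) (mem_joinLabels_of_mem hl hl' hab.mem_D)
    rwa [hJy] at this
  have hgz : g ∈ z.D := mem_D_of_le hl hl' hjz (by rw [hj]; rfl) fun k a b _ hab hbz hgk =>
    not_le_of_lt hgk (hlab k a b hab hbz)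
  have hhx : h ∈ x.U := by
    refine (hxU h).2 ⟨fun hh => hh.2 (.refl h), fun u hu hhu => hxU.subset hu ?_⟩
    replace hhu : G.Adj h u := hhu
    exact ⟨(le_of_adj hhu).trans (le_of_adj hgh), not_le_of_lt (lt_of_adj hhu)⟩
  have hhz : h ∈ z.U := by
    refine mem_U_of_le hl hl' hxz hhx fun k a b hxa hab hbz hkh => ?_
    have hk := meetLabels_anti hxa (mem_meetLabels_of_mem hl hl' hab.mem_U)
    rw [hMx] at hk
    -- A label `k ≤ h` that could remove `h` lies below `g` but outside the down-set of `x`, hence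
    -- above `h`. So `k = h`, and then `j_h ≤ z ≤ m_h`, which is excluded.
    have hhk : G.Le h k := by
      by_contra hhk
      exact hk ⟨hlab k a b hab hbz, hhk⟩
    obtain rfl := hkh.antisymm hhk
    obtain ⟨i, hi, hib⟩ := mem_joinLabels_of_mem hl hl' hab.mem_D
    exact not_le_of_D_eq_of_U_eq hl hl' hL hi hm (hib.trans (hbz.trans hzm))
  exact z.tight.orthogonal.not_adj g hgz h hhz hgh

theorem D_le_U_iff (hl : G.IsLinearExtension l) (hl' : G.IsReverseLinearExtension l')
    (hL : IsLatticePoset (G.Tops l l')) {g h : V} {j m : G.Tops l l'}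
    (hj : j.D = {g}) (hm : m.U = {h}) : j ≤ m ↔ G.NonEdge g h := by
  constructor
  · intro hjm
    refine ⟨?_, fun hgh => not_le_of_adj hl hl' hL hgh hj hm hjm⟩
    rintro rfl
    exact not_le_of_D_eq_of_U_eq hl hl' hL hj hm hjm
  · rintro ⟨hne, hadj⟩
    refine le_of_mem_joinLabels (mem_joinLabels_of_not_adj hl hl' ?_ ?_) hj <;> rw [hm]
    · exact hne
    · rintro _ rfl
      exact hadj

theorem mem_meetLabels_iff (hl : G.IsLinearExtension l) (hl' : G.IsReverseLinearExtension l')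
    (hL : IsLatticePoset (G.Tops l l')) (x : G.Tops l l') (h : V) :
    h ∈ meetLabels x ↔ ∀ g ∈ joinLabels x, G.NonEdge g h := by
  obtain ⟨m, hm⟩ := exists_U_eq_singleton (l := l) hl' h
  constructor
  · rintro hh g ⟨j, hj, hjx⟩
    exact (D_le_U_iff hl hl' hL hj hm).1 (hjx.trans (le_of_mem_meetLabels hl hl' hh hm))
  · refine fun hx => ⟨m, hm, le_of_joinLabels_subset hl hl' hL ?_⟩
    rintro g ⟨j, hj, hjx⟩
    exact ⟨j, hj, (D_le_U_iff hl hl' hL hj hm).2 (hx g ⟨j, hj, hjx⟩)⟩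

theorem mem_joinLabels_iff (hl : G.IsLinearExtension l) (hl' : G.IsReverseLinearExtension l')
    (hL : IsLatticePoset (G.Tops l l')) (x : G.Tops l l') (h : V) :
    h ∈ joinLabels x ↔ ∀ g ∈ meetLabels x, G.NonEdge h g := by
  have := mem_meetLabels_iff hl'.op hl.op (isLatticePoset_op hl hl' hL) x.op h
  rw [joinLabels_op hl hl', ← joinLabels_op hl'.op hl.op] at this
  refine this.trans (forall₂_congr fun g _ => ?_)
  simp [NonEdge, op_adj, ne_comm]

theorem exists_isLUB (hl : G.IsLinearExtension l) (hl' : G.IsReverseLinearExtension l')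
    (hL : IsLatticePoset (G.Tops l l')) (S : Set (G.Tops l l')) : ∃ x, IsLUB S x := by
  induction S, S.toFinite using Set.Finite.induction_on with
  | empty =>
    obtain ⟨x, hx⟩ := IsIndependent.exists_tops (G := G) (l' := l') hl (D := ∅)
      (by simp [IsIndependent])
    exact ⟨x, by simp [upperBounds], fun y _ => Tops.le_of_D_eq_empty hl hl' hx⟩
  | @insert a S _ _ ih =>
    obtain ⟨x, hx⟩ := ih
    obtain ⟨⟨y, hy⟩, -⟩ := hL a x
    refine ⟨y, ?_, fun z hz => hy.2 ?_⟩
    · rintro z (rfl | hz)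
      · exact hy.1 (.inl rfl)
      · exact (hx.1 hz).trans (hy.1 (.inr rfl))
    · rintro w (rfl | rfl)
      · exact hz (.inl rfl)
      · exact hx.2 fun v hv => hz (.inr hv)

/-- The top is the join of the `j_g` with `g` in the extent. -/
theorem exists_tops_of_mops (hl : G.IsLinearExtension l) (hl' : G.IsReverseLinearExtension l')
    (hL : IsLatticePoset (G.Tops l l')) (c : G.Mops) :
    ∃ x : G.Tops l l', joinLabels x = c.extent ∧ meetLabels x = c.intent := by
  obtain ⟨x, hx⟩ := exists_isLUB hl hl' hL {j | ∃ g ∈ c.extent, j.D = {g}}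
  have hM : meetLabels x = c.intent := by
    ext h
    rw [← c.upperPolar_extent]
    obtain ⟨m, hm⟩ := exists_U_eq_singleton (l := l) hl' h
    constructor
    · intro hh g hg
      obtain ⟨j, hj⟩ := exists_D_eq_singleton (l' := l') hl g
      exact (D_le_U_iff hl hl' hL hj hm).1
        ((hx.1 ⟨g, hg, hj⟩).trans (le_of_mem_meetLabels hl hl' hh hm))
    · refine fun hh => ⟨m, hm, hx.2 ?_⟩
      rintro j ⟨g, hg, hj⟩
      exact (D_le_U_iff hl hl' hL hj hm).2 (hh hg)
  refine ⟨x, ?_, hM⟩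
  ext h
  rw [mem_joinLabels_iff hl hl' hL, hM, ← c.lowerPolar_intent]
  rfl

/-- If the independence poset is a lattice, then the two components of the pairs in a cover
relation of `L(G)` overlap. -/
theorem exists_mem_inter_of_isLatticePoset (hl : G.IsLinearExtension l)
    (hl' : G.IsReverseLinearExtension l') (hL : IsLatticePoset (G.Tops l l')) {c d : G.Mops}
    (h : c ⋖ d) : ∃ g, g ∈ c.intent ∩ d.extent := by
  obtain ⟨x, hx, hx'⟩ := exists_tops_of_mops hl hl' hL c
  obtain ⟨y, hy, hy'⟩ := exists_tops_of_mops hl hl' hL d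
  have hxy : x < y := by
    refine lt_of_le_of_ne (le_of_joinLabels_subset hl hl' hL ?_) ?_
    · rw [hx, hy]
      exact Concept.extent_subset_extent_iff.2 h.le
    · rintro rfl
      exact h.lt.ne (Concept.ext (hx.symm.trans hy))
  obtain ⟨g, z, hg, hzy⟩ := exists_step_of_lt hl hl' hxy
  refine ⟨g, ?_, ?_⟩
  · rw [← hx']
    exact mem_meetLabels_of_mem hl hl' hg.mem_U
  · rw [← hy]
    exact joinLabels_mono hzy (mem_joinLabels_of_mem hl hl' hg.mem_D)

end TopsOrder

end AcyclicDigraph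

/-! ### Left modular elements and irreducible elements of lattices -/

section Lattice

variable {L : Type*} [Lattice L] [Finite L]

/-- Left modularity can be checked on cover relations. -/
theorem isLeftModularElement_of_covBy {x : L}
    (h : ∀ y z : L, y ⋖ z → (y ⊔ x) ⊓ z = y ⊔ (x ⊓ z)) : IsLeftModularElement x := by
  intro y z hyz
  have hle : y ⊔ (x ⊓ z) ≤ (y ⊔ x) ⊓ z :=
    sup_le (le_inf le_sup_left hyz) (inf_le_inf_right z le_sup_right)
  -- A strict inequality gives a `c` above the right side and covered by the left side; the identity
  -- already fails on this cover.
  refine (hle.eq_or_lt.resolve_right fun hlt => ?_).symm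
  obtain ⟨c, hac, hcb⟩ := exists_le_covBy_of_lt hlt
  have h1 := h c _ hcb
  have h2 : (y ⊔ x) ⊓ z ≤ c ⊔ x :=
    inf_le_left.trans (sup_le_sup_right (le_sup_left.trans hac) x)
  have h3 : x ⊓ ((y ⊔ x) ⊓ z) ≤ c :=
    (le_inf inf_le_left (inf_le_right.trans inf_le_right)).trans (le_sup_right.trans hac)
  rw [inf_eq_right.2 h2, sup_eq_left.2 h3] at h1
  exact hcb.lt.ne h1.symm

/-- A maximal chain of left modular elements labels each cover relation by one of its own cover
relations. -/
theorem exists_covBy_of_isLeftModularElement [BoundedOrder L] {C : Set L}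
    (hC : IsMaxChain (· ≤ ·) C) (hmod : ∀ x ∈ C, IsLeftModularElement x) {y z : L} (h : y ⋖ z) :
    ∃ x ∈ C, ∃ x' ∈ C, x ⋖ x' ∧ x ⊓ z ≤ y ∧ ¬ x' ⊓ z ≤ y ∧ ¬ z ≤ y ⊔ x ∧ z ≤ y ⊔ x' := by
  -- `x` is the last element of the chain with `x ⊓ z ≤ y`, and `x'` is the next one. Left
  -- modularity turns these meet conditions into the join conditions.
  obtain ⟨x, ⟨hxC, hxy⟩, hx⟩ := (Set.toFinite {c ∈ C | c ⊓ z ≤ y}).exists_maximal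
    ⟨⊥, hC.bot_mem, by simp⟩
  obtain ⟨x', ⟨hxC', hxy'⟩, hx'⟩ := (Set.toFinite {c ∈ C | ¬ c ⊓ z ≤ y}).exists_minimal
    ⟨⊤, hC.top_mem, by simpa using h.lt.not_ge⟩
  have hle : ∀ c ∈ C, c ⊓ z ≤ y → c ≤ x := fun c hc hcy =>
    (hC.1.total hc hxC).elim id fun h => hx ⟨hc, hcy⟩ h
  have hge : ∀ c ∈ C, ¬ c ⊓ z ≤ y → x' ≤ c := fun c hc hcy =>
    (hC.1.total hxC' hc).elim id fun h => hx' ⟨hc, hcy⟩ h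
  have hlt : x < x' := by
    have : ¬ x' ≤ x := fun h => hxy' ((inf_le_inf_right z h).trans hxy)
    exact lt_of_le_not_ge ((hC.1.total hxC hxC').resolve_right this) this
  refine ⟨x, hxC, x', hxC', ⟨hlt, fun w hxw hwx => ?_⟩, hxy, hxy', fun hzx => ?_, ?_⟩
  · have hchain : IsChain (· ≤ ·) (insert w C) := by
      refine hC.1.insert fun c hc _ => ?_
      by_cases hcy : c ⊓ z ≤ y
      · exact .inr ((hle c hc hcy).trans hxw.le)
      · exact .inl (hwx.le.trans (hge c hc hcy))
    have hw : w ∈ C := by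
      rw [hC.2 hchain (Set.subset_insert w C)]
      exact Set.mem_insert w C
    by_cases hwy : w ⊓ z ≤ y
    · exact hxw.not_ge (hle w hw hwy)
    · exact hwx.not_ge (hge w hw hwy)
  · have := hmod x hxC y z h.le
    rw [inf_eq_right.2 hzx, sup_eq_left.2 hxy] at this
    exact h.lt.ne this.symm
  · have h1 := hmod x' hxC' y z h.le
    have h2 : y ⊔ (x' ⊓ z) = z := by
      refine (sup_le h.le inf_le_right).eq_of_not_lt fun h3 => ?_
      exact h.2 (left_lt_sup.2 hxy') h3
    rw [h2] at h1
    exact inf_eq_right.1 h1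

end Lattice

namespace AcyclicDigraph

/-! ### Maximal orthogonal pairs -/

section Mops

variable {V : Type*} {G : AcyclicDigraph V}

theorem Mops.mem_intent_iff (c : G.Mops) (h : V) :
    h ∈ c.intent ↔ ∀ g ∈ c.extent, G.NonEdge g h := by
  rw [← c.upperPolar_extent]
  rfl

theorem Mops.mem_extent_iff (c : G.Mops) (g : V) :
    g ∈ c.extent ↔ ∀ h ∈ c.intent, G.NonEdge g h := by
  rw [← c.lowerPolar_intent]
  rfl

theorem Mops.notMem_intent {c : G.Mops} {g : V} (h : g ∈ c.extent) : g ∉ c.intent := fun h' =>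
  ((c.mem_intent_iff g).1 h' g h).1 rfl

theorem Mops.not_adj (c : G.Mops) {g h : V} (hg : g ∈ c.extent) (hh : h ∈ c.intent) :
    ¬ G.Adj g h := ((c.mem_intent_iff h).1 hh g hg).2

theorem Mops.le_iff {c d : G.Mops} : c ≤ d ↔ c.extent ⊆ d.extent :=
  Concept.extent_subset_extent_iff.symm

theorem Mops.le_iff_intent {c d : G.Mops} : c ≤ d ↔ d.intent ⊆ c.intent :=
  Concept.intent_subset_intent_iff.symm

theorem op_nonEdge {a b : V} : G.op.NonEdge a b ↔ G.NonEdge b a := by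
  simp [NonEdge, op_adj, ne_comm]

/-- The maximal orthogonal pair of the opposite digraph obtained by exchanging the two
components. -/
def Mops.op (c : G.Mops) : G.op.Mops where
  extent := c.intent
  intent := c.extent
  upperPolar_extent := by
    ext g
    rw [c.mem_extent_iff]
    exact forall₂_congr fun _ _ => op_nonEdge
  lowerPolar_intent := by
    ext g
    rw [c.mem_intent_iff]
    exact forall₂_congr fun _ _ => op_nonEdge

variable (G) in
/-- The lattice of maximal orthogonal pairs of the opposite digraph is the dual lattice. -/
def Mops.opIso : G.Mopsᵒᵈ ≃o G.op.Mops where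
  toFun c := Mops.op (OrderDual.ofDual c)
  invFun c := OrderDual.toDual (Mops.op c)
  left_inv _ := rfl
  right_inv _ := rfl
  map_rel_iff' := Mops.le_iff.trans Mops.le_iff_intent.symm

theorem Mops.op_covBy_op {c d : G.Mops} (h : c ⋖ d) : Mops.op d ⋖ Mops.op c :=
  (apply_covBy_apply_iff (Mops.opIso G)).2 h.toDual

/-! ### Labels of the cover relations of `L(G)` -/

/-- Since `g` lies in `d.extent` but not in `c.extent`, `d` is the join of `c` with the concept
generated by `g`. -/
theorem CovBy.mem_intent_iff {c d : G.Mops} (h : c ⋖ d) {g : V} (hg : g ∈ c.intent ∩ d.extent)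
    (k : V) : k ∈ d.intent ↔ k ∈ c.intent ∧ G.NonEdge g k := by
  have hlt : c < c ⊔ Concept.ofObject G.NonEdge g := by
    refine left_lt_sup.2 fun hle => ?_
    rw [Concept.ofObjects_le_iff, Set.singleton_subset_iff] at hle
    exact Mops.notMem_intent hle hg.1
  have hle : c ⊔ Concept.ofObject G.NonEdge g ≤ d :=
    sup_le h.le (Concept.ofObjects_le_iff.2 (Set.singleton_subset_iff.2 hg.2))
  have heq := hle.eq_of_not_lt (h.2 hlt)
  rw [← heq, Concept.intent_sup]
  simp

theorem CovBy.mem_extent_iff {c d : G.Mops} (h : c ⋖ d) {g : V} (hg : g ∈ c.intent ∩ d.extent)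
    (k : V) : k ∈ c.extent ↔ k ∈ d.extent ∧ G.NonEdge k g :=
  (CovBy.mem_intent_iff (Mops.op_covBy_op h) hg.symm k).trans (and_congr_right' op_nonEdge)

/-- Two distinct labels would be joined by edges in both directions. -/
theorem CovBy.label_unique {c d : G.Mops} (h : c ⋖ d) {g k : V}
    (hg : g ∈ c.intent ∩ d.extent) (hk : k ∈ c.intent ∩ d.extent) : g = k := by
  by_contra hne
  have key : ∀ {g k : V}, g ≠ k → g ∈ c.intent ∩ d.extent → k ∈ c.intent ∩ d.extent →
      G.Adj g k := fun {g k} hne hg hk => by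
    by_contra hadj
    exact Mops.notMem_intent hk.2 ((CovBy.mem_intent_iff h hg k).2 ⟨hk.1, hne, hadj⟩)
  exact not_le_of_lt (lt_of_adj (key hne hg hk)) (le_of_adj (key (Ne.symm hne) hk hg))

theorem CovBy.inter_eq_singleton {c d : G.Mops} (h : c ⋖ d) {g : V}
    (hg : g ∈ c.intent ∩ d.extent) : c.intent ∩ d.extent = {g} :=
  Set.eq_singleton_iff_unique_mem.2 ⟨hg, fun _ hk => CovBy.label_unique h hk hg⟩

theorem mem_downLabels_iff {d : G.Mops} {g : V} :
    g ∈ downLabels d ↔ ∃ c : G.Mops, c ⋖ d ∧ g ∈ c.intent ∩ d.extent :=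
  exists_congr fun _ => and_congr_right fun h =>
    ⟨fun hg => hg ▸ rfl, CovBy.inter_eq_singleton h⟩

theorem mem_upLabels_iff {c : G.Mops} {g : V} :
    g ∈ upLabels c ↔ ∃ d : G.Mops, c ⋖ d ∧ g ∈ c.intent ∩ d.extent :=
  exists_congr fun _ => and_congr_right fun h =>
    ⟨fun hg => hg ▸ rfl, CovBy.inter_eq_singleton h⟩

theorem downLabels_op (c : G.Mops) : downLabels (Mops.op c) = upLabels c := by
  ext g
  rw [mem_downLabels_iff, mem_upLabels_iff]
  constructor
  · rintro ⟨d, hd, hg⟩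
    exact ⟨Mops.op d, Mops.op_covBy_op hd, hg.symm⟩
  · rintro ⟨d, hd, hg⟩
    exact ⟨Mops.op d, Mops.op_covBy_op hd, hg.symm⟩

theorem downLabels_subset (d : G.Mops) : downLabels d ⊆ d.extent := fun _ hg =>
  let ⟨_, _, h⟩ := mem_downLabels_iff.1 hg
  h.2

theorem upLabels_subset (c : G.Mops) : upLabels c ⊆ c.intent := fun _ hg =>
  let ⟨_, _, h⟩ := mem_upLabels_iff.1 hg
  h.1

/-! ### Consequences of overlapping covers -/

instance [Finite V] : Finite G.Mops := Finite.of_injective _ Concept.extent_injective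

variable (G) in
/-- All cover relations of `L(G)` overlap. -/
def IsOverlapping : Prop := ∀ c d : G.Mops, c ⋖ d → ∃ g, g ∈ c.intent ∩ d.extent

theorem IsOverlapping.op (h : G.IsOverlapping) : G.op.IsOverlapping := fun c d hcd =>
  (h (Mops.op d) (Mops.op c) (Mops.op_covBy_op hcd)).imp fun _ hg => hg.symm

variable [Finite V]

/-- The down labels generate `c`: a smaller generated concept would lie below some `w ⋖ c`, whose
label would be in both `w.extent` and `w.intent`. -/
theorem IsOverlapping.mem_intent_iff (hG : G.IsOverlapping) (c : G.Mops) (h : V) :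
    h ∈ c.intent ↔ h ∉ downLabels c ∧ ∀ d ∈ downLabels c, ¬ G.Adj d h := by
  constructor
  · exact fun hh => ⟨fun hd => Mops.notMem_intent (downLabels_subset c hd) hh,
      fun d hd => c.not_adj (downLabels_subset c hd) hh⟩
  · rintro ⟨hh, hadj⟩
    by_contra hc
    have hle : Concept.ofObjects G.NonEdge (downLabels c) ≤ c :=
      Concept.ofObjects_le_iff.2 (downLabels_subset c)
    have hlt := hle.lt_of_ne fun heq => hc <| by
      rw [← heq]
      exact fun d hd => ⟨fun e => hh (e ▸ hd), hadj d hd⟩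
    obtain ⟨w, hw, hwc⟩ := exists_le_covBy_of_lt hlt
    obtain ⟨g, hg⟩ := hG w c hwc
    have := Concept.ofObjects_le_iff.1 hw (mem_downLabels_iff.2 ⟨w, hwc, hg⟩)
    exact Mops.notMem_intent this hg.1

/-- Climb from `b` towards `c` until a cover removes `q` from the intent. The label of that cover is
not `q`, so it has an edge to `q`. -/
theorem IsOverlapping.exists_adj (hG : G.IsOverlapping) {b c : G.Mops} (hbc : b ≤ c) {q : V}
    (hb : q ∈ b.intent) (hc : q ∉ c.intent) (hc' : q ∉ c.extent) :
    ∃ r ∈ b.intent, r ∈ c.extent ∧ G.Adj r q := by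
  obtain ⟨u, ⟨hbu, huc, hqu⟩, hu⟩ :=
    (Set.toFinite {u : G.Mops | b ≤ u ∧ u ≤ c ∧ q ∈ u.intent}).exists_maximal
      ⟨b, le_rfl, hbc, hb⟩
  have huc' : u < c := huc.lt_of_ne fun h => hc (h ▸ hqu)
  obtain ⟨v, huv, hvc⟩ := exists_covBy_le_of_lt huc'
  have hqv : q ∉ v.intent := fun hqv =>
    huv.lt.not_ge (hu ⟨hbu.trans huv.le, hvc, hqv⟩ huv.le)
  obtain ⟨r, hr⟩ := hG u v huv
  refine ⟨r, Mops.le_iff_intent.1 hbu hr.1, Mops.le_iff.1 hvc hr.2, ?_⟩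
  by_contra hadj
  refine hqv ((CovBy.mem_intent_iff huv hr q).2 ⟨hqu, ?_, hadj⟩)
  rintro rfl
  exact hc' (Mops.le_iff.1 hvc hr.2)

theorem IsOverlapping.isIndependent_downLabels (hG : G.IsOverlapping) (c : G.Mops) :
    G.IsIndependent (downLabels c) := by
  intro p hp g hg hpg
  obtain ⟨w, hw, hgw⟩ := mem_downLabels_iff.1 hg
  obtain ⟨w', hw', hpw⟩ := mem_downLabels_iff.1 hp
  -- From such a `q` in `c.extent`, uniqueness of labels keeps `q` out of both components of `w` or
  -- of `w'`, and `exists_adj` yields a strictly larger vertex of the same kind. This cannot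
  -- continue forever; `q = p` is the case needed.
  have key : ∀ q, G.Lt g q → q ∈ (w ⊓ w').intent → q ∉ c.extent := by
    intro q
    induction q using G.wellFounded_gt.induction with
    | _ q ih =>
      intro hgq hqb hqc
      have hne : q ≠ g := by
        rintro rfl
        exact G.acyclic _ hgq
      by_cases hqw : q ∈ w.extent
      · have hqw' : q ∉ w'.extent := fun h => Mops.notMem_intent (c := w ⊓ w') ⟨hqw, h⟩ hqb
        have hqp : q ≠ p := by
          rintro rfl
          exact w.not_adj hqw hgw.1 hpg
        have hqi : q ∉ w'.intent := fun h => hqp (CovBy.label_unique hw' ⟨h, hqc⟩ hpw)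
        obtain ⟨r, hr, hrw, hrq⟩ := hG.exists_adj inf_le_right hqb hqi hqw'
        exact ih r (lt_of_adj hrq) (hgq.trans (lt_of_adj hrq)) hr (Mops.le_iff.1 hw'.le hrw)
      · have hqi : q ∉ w.intent := fun h => hne (CovBy.label_unique hw ⟨h, hqc⟩ hgw)
        obtain ⟨r, hr, hrw, hrq⟩ := hG.exists_adj inf_le_left hqb hqi hqw
        exact ih r (lt_of_adj hrq) (hgq.trans (lt_of_adj hrq)) hr (Mops.le_iff.1 hw.le hrw)
  exact key p (lt_of_adj hpg) (Mops.le_iff_intent.1 inf_le_right hpw.1) hpw.2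

theorem IsOverlapping.isIndependent_upLabels (hG : G.IsOverlapping) (c : G.Mops) :
    G.IsIndependent (upLabels c) := fun a ha b hb hab => by
  rw [← downLabels_op] at ha hb
  exact hG.op.isIndependent_downLabels _ b hb a ha hab

theorem IsOverlapping.mem_extent_iff (hG : G.IsOverlapping) (c : G.Mops) (h : V) :
    h ∈ c.extent ↔ h ∉ upLabels c ∧ ∀ u ∈ upLabels c, ¬ G.Adj h u := by
  rw [← downLabels_op]
  exact hG.op.mem_intent_iff (Mops.op c) h

theorem IsOverlapping.isTight (hG : G.IsOverlapping) (c : G.Mops) :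
    G.IsTight (downLabels c) (upLabels c) := by
  refine isTight_of_exists_adj ⟨hG.isIndependent_downLabels c, hG.isIndependent_upLabels c,
    Set.disjoint_left.2 fun g hg hg' => Mops.notMem_intent (downLabels_subset c hg)
      (upLabels_subset c hg'),
    fun d hd u hu => c.not_adj (downLabels_subset c hd) (upLabels_subset c hu)⟩ fun k hkD hkU => ?_
  by_contra! hc
  exact Mops.notMem_intent ((hG.mem_extent_iff c k).2 ⟨hkU, hc.2⟩)
    ((hG.mem_intent_iff c k).2 ⟨hkD, hc.1⟩)

theorem IsOverlapping.isKernel (hG : G.IsOverlapping) (c : G.Mops) :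
    G.IsKernel c.extent (downLabels c) := by
  intro k
  constructor
  · exact fun hk => ⟨downLabels_subset c hk, fun d hd => hG.isIndependent_downLabels c d hd k hk⟩
  · rintro ⟨hk, hk'⟩
    by_contra hkD
    exact Mops.notMem_intent hk ((hG.mem_intent_iff c k).2 ⟨hkD, hk'⟩)

/-- The pair of the downward and the upward labels, as a top. -/
def IsOverlapping.toTops (hG : G.IsOverlapping) (l l' : List V) (c : G.Mops) : G.Tops l l' :=
  ⟨downLabels c, upLabels c, hG.isTight c⟩

/-! ### The isomorphism between `L(G)` and `top(G)` -/

variable {l l' : List V}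

theorem IsOverlapping.toTops_injective (hG : G.IsOverlapping) :
    Function.Injective (hG.toTops l l') := by
  intro c d h
  have hD : downLabels c = downLabels d := congrArg Tops.D h
  refine Concept.ext' (Set.ext fun k => ?_)
  rw [hG.mem_intent_iff c, hG.mem_intent_iff d, hD]

/-- The concept generated by `t.D` has `t.U` in its intent, so `t.D` is the kernel of its extent, as
is its set of down labels. -/
theorem IsOverlapping.toTops_surjective (hG : G.IsOverlapping) :
    Function.Surjective (hG.toTops l l') := by
  intro t
  set c : G.Mops := Concept.ofObjects G.NonEdge t.D
  have hDc : t.D ⊆ c.extent := Concept.ofObjects_le_iff.1 le_rfl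
  have hUc : t.U ⊆ c.intent := fun u hu d hd =>
    ⟨fun e => Set.disjoint_left.1 t.tight.orthogonal.disjoint hd (e ▸ hu),
      t.tight.orthogonal.not_adj d hd u hu⟩
  refine ⟨c, Tops.ext_D ((hG.isKernel c).unique fun k => ?_)⟩
  constructor
  · exact fun hk => ⟨hDc hk, fun d hd => t.tight.orthogonal.independent_left d hd k hk⟩
  · rintro ⟨hk, hk'⟩
    exact (t.tight.isKernel k).2 ⟨⟨fun h => Mops.notMem_intent hk (hUc h),
      fun u hu => c.not_adj hk (hUc hu)⟩, hk'⟩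

theorem IsOverlapping.mem_downLabels_iff_of_not_le (hG : G.IsOverlapping) {c d : G.Mops}
    (h : c ⋖ d) {g : V} (hg : g ∈ c.intent ∩ d.extent) {k : V} (hk : ¬ G.Le k g) :
    k ∈ downLabels c ↔ k ∈ downLabels d := by
  have hgd : g ∈ downLabels d := mem_downLabels_iff.2 ⟨c, h, hg⟩
  -- `d.extent` may exceed `c.extent` by more than `g`, but each further vertex has an edge to or
  -- from `g`, and only `insert g c.extent` matters for the kernel.
  have hker : G.IsKernel (insert g c.extent) (downLabels d) := by
    intro k
    rw [hG.isKernel d k]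
    constructor
    · refine fun hk => ⟨?_, hk.2⟩
      by_cases hkg : k = g
      · exact .inl hkg
      · exact .inr ((CovBy.mem_extent_iff h hg k).2 ⟨hk.1, hkg, fun hadj =>
          hG.isIndependent_downLabels d k ((hG.isKernel d k).2 hk) g hgd hadj⟩)
    · rintro ⟨rfl | hk, hk'⟩
      · exact ⟨hg.2, hk'⟩
      · exact ⟨Mops.le_iff.1 h.le hk, hk'⟩
  refine (hG.isKernel c).mem_iff_of_not_le hker (fun i hi => ?_) hk
  have : i ≠ g := by
    rintro rfl
    exact hi (.refl _)
  simp [this]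

theorem IsOverlapping.step (hG : G.IsOverlapping) {c d : G.Mops} (h : c ⋖ d) {g : V}
    (hg : g ∈ c.intent ∩ d.extent) : Step g (hG.toTops l l' c) (hG.toTops l l' d) := by
  refine ⟨mem_upLabels_iff.2 ⟨d, h, hg⟩, mem_downLabels_iff.2 ⟨c, h, hg⟩,
    fun k hk => hG.mem_downLabels_iff_of_not_le h hg hk, fun k hk => ?_⟩
  change k ∈ upLabels c ↔ k ∈ upLabels d
  rw [← downLabels_op, ← downLabels_op]
  exact (hG.op.mem_downLabels_iff_of_not_le (Mops.op_covBy_op h) hg.symm (mt G.op_le.1 hk)).symm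

theorem IsOverlapping.toTops_le_toTops (hG : G.IsOverlapping) (hl : G.IsLinearExtension l)
    (hl' : G.IsReverseLinearExtension l') {c d : G.Mops} :
    hG.toTops l l' c ≤ hG.toTops l l' d ↔ c ≤ d := by
  constructor
  · intro h
    refine Tops.le_induction hl hl' h (P := fun t => ∀ d, hG.toTops l l' d = t → c ≤ d) ?_ ?_ d rfl
    · exact fun d hd => (hG.toTops_injective hd).ge
    · rintro g a b - hab - ih d rfl
      obtain ⟨e, rfl⟩ := hG.toTops_surjective a
      obtain ⟨f, hf, hgf⟩ := mem_upLabels_iff.1 hab.mem_U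
      obtain rfl := hG.toTops_injective (hab.unique (hG.step hf hgf))
      exact (ih e rfl).trans hf.le
  · intro h
    induction c using WellFoundedGT.induction with
    | _ c ih =>
      rcases h.eq_or_lt with rfl | hlt
      · exact le_rfl
      · obtain ⟨e, he, hed⟩ := exists_covBy_le_of_lt hlt
        obtain ⟨g, hg⟩ := hG c e he
        exact ((hG.step he hg).lt hl hl').le.trans (ih e he.lt hed)

/-- If all cover relations of `L(G)` overlap, then `L(G)` is isomorphic to `top(G)`. -/
theorem IsOverlapping.exists_orderIso (hG : G.IsOverlapping) (hl : G.IsLinearExtension l)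
    (hl' : G.IsReverseLinearExtension l') :
    ∃ φ : G.Mops ≃o G.Tops l l', ∀ c, (φ c).D = downLabels c ∧ (φ c).U = upLabels c :=
  ⟨⟨Equiv.ofBijective (hG.toTops l l') ⟨hG.toTops_injective, hG.toTops_surjective⟩,
    hG.toTops_le_toTops hl hl'⟩, fun _ => ⟨rfl, rfl⟩⟩

theorem IsOverlapping.isLatticePoset (hG : G.IsOverlapping) (hl : G.IsLinearExtension l)
    (hl' : G.IsReverseLinearExtension l') : IsLatticePoset (G.Tops l l') := by
  obtain ⟨φ, -⟩ := hG.exists_orderIso hl hl'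
  intro x y
  refine ⟨⟨φ (φ.symm x ⊔ φ.symm y), ?_⟩, φ (φ.symm x ⊓ φ.symm y), ?_⟩
  · have := φ.isLUB_image'.2 (isLUB_pair (a := φ.symm x) (b := φ.symm y))
    rwa [Set.image_pair, φ.apply_symm_apply, φ.apply_symm_apply] at this
  · have := φ.isGLB_image'.2 (isGLB_pair (a := φ.symm x) (b := φ.symm y))
    rwa [Set.image_pair, φ.apply_symm_apply, φ.apply_symm_apply] at this

end Mops

section Trim

variable {V : Type*} {G : AcyclicDigraph V}

/-! ### Maximal orthogonal pairs that cover all the vertices -/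

/-- The maximal orthogonal pair formed by a down-set and its complement. -/
def Mops.ofDownset (X : Set V) (hX : ∀ a ∈ X, ∀ b, G.Adj a b → b ∈ X) : G.Mops where
  extent := X
  intent := Xᶜ
  upperPolar_extent := by
    ext h
    refine ⟨fun hh hX' => (hh hX').1 rfl, fun hh a ha => ⟨fun e => hh (e ▸ ha), fun hah => ?_⟩⟩
    exact hh (hX a ha h hah)
  lowerPolar_intent := by
    ext a
    refine ⟨fun ha => ?_, fun ha h hh => ⟨fun e => hh (e ▸ ha), fun hah => hh (hX a ha h hah)⟩⟩
    by_contra hc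
    exact (ha hc).1 rfl

theorem Mops.covBy_of_extent_eq_insert {c d : G.Mops} {g : V} (hg : g ∉ c.extent)
    (h : d.extent = insert g c.extent) : c ⋖ d := by
  refine ⟨lt_of_le_not_ge ?_ fun hdc => ?_, fun e hce hed => ?_⟩
  · rw [Mops.le_iff, h]
    exact Set.subset_insert _ _
  · exact hg (Mops.le_iff.1 hdc (h ▸ .inl rfl))
  · have h1 := Mops.le_iff.1 hce.le
    have h2 := Mops.le_iff.1 hed.le
    by_cases hge : g ∈ e.extent
    · refine hed.not_ge (Mops.le_iff.2 ?_)
      rw [h]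
      exact Set.insert_subset hge h1
    · refine hce.not_ge (Mops.le_iff.2 fun k hk => ?_)
      rcases h ▸ h2 hk with rfl | hk'
      · exact absurd hk hge
      · exact hk'

/-- On a cover `y ⋖ z` with label `g`, both sides of the modular identity equal `z` if `g ∈
c.extent`, and `y` if `g ∈ c.intent`. -/
theorem IsOverlapping.isLeftModularElement [Finite V] (hG : G.IsOverlapping) {c : G.Mops}
    (hc : ∀ v, v ∈ c.extent ∨ v ∈ c.intent) : IsLeftModularElement c := by
  refine isLeftModularElement_of_covBy fun y z hyz => ?_
  obtain ⟨g, hg⟩ := hG y z hyz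
  have hle : y ⊔ (c ⊓ z) ≤ (y ⊔ c) ⊓ z :=
    sup_le (le_inf le_sup_left hyz.le) (inf_le_inf_right z le_sup_right)
  rcases hc g with hgc | hgc
  · have h1 : y < y ⊔ (c ⊓ z) := left_lt_sup.2 fun h =>
      Mops.notMem_intent (Mops.le_iff.1 h ⟨hgc, hg.2⟩) hg.1
    have h2 : y ⊔ (c ⊓ z) = z :=
      (sup_le hyz.le inf_le_right).eq_of_not_lt fun h3 => hyz.2 h1 h3
    exact le_antisymm (inf_le_right.trans h2.ge) hle
  · have h1 : c ⊓ z ≤ y := by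
      refine Mops.le_iff.2 fun k hk => (CovBy.mem_extent_iff hyz hg k).2 ⟨hk.2, ?_, ?_⟩
      · rintro rfl
        exact Mops.notMem_intent hk.1 hgc
      · exact c.not_adj hk.1 hgc
    have h2 : (y ⊔ c) ⊓ z < z := inf_lt_right.2 fun h => by
      refine Mops.notMem_intent (Mops.le_iff.1 h hg.2) ?_
      rw [Concept.intent_sup]
      exact ⟨hg.1, hgc⟩
    have h3 : y = (y ⊔ c) ⊓ z :=
      (le_inf le_sup_left hyz.le).eq_of_not_lt fun h3 => hyz.2 h3 h2
    rw [← h3, sup_eq_left.2 h1]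

/-- In a left modular lattice `L(G)` all cover relations overlap. -/
theorem isOverlapping_of_isLeftModularLattice [Finite V] (h : IsLeftModularLattice G.Mops) :
    G.IsOverlapping := by
  obtain ⟨C, hC, hmod⟩ := h
  -- each vertex is the label of some cover relation of the chain
  have hv : ∀ v, ∃ x ∈ C, ∃ x' ∈ C, x ⋖ x' ∧ v ∈ x.intent ∩ x'.extent := by
    intro v
    -- The extents of `y` and `z` differ only in `v`, so the chain cover attached to `y ⋖ z` can
    -- only have label `v`.
    set z : G.Mops := Mops.ofDownset {k | G.Le k v} (downset_adj v)
    set y : G.Mops := Mops.ofDownset {k | G.Lt k v} (fun a ha b hab => (lt_of_adj hab).trans ha)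
    have hyz : y ⋖ z := by
      refine Mops.covBy_of_extent_eq_insert (G.acyclic v) (Set.ext fun k => ⟨fun hk => ?_, ?_⟩)
      · by_cases hkv : k = v
        · exact .inl hkv
        · exact .inr (Le.lt_of_ne hk hkv)
      · rintro (rfl | hk)
        · exact Le.refl _
        · exact Lt.le hk
    have hzy : ∀ k, k ∈ z.extent → k ∉ y.extent → k = v := fun k hk hk' => by
      by_contra hne
      exact hk' (Le.lt_of_ne hk hne)
    obtain ⟨x, hx, x', hx', hxx', h1, h2, h3, h4⟩ :=
      exists_covBy_of_isLeftModularElement hC hmod hyz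
    refine ⟨x, hx, x', hx', hxx', ?_, ?_⟩
    · by_contra hc
      refine h3 (Mops.le_iff_intent.2 fun k hk => ?_)
      rw [Concept.intent_sup] at hk
      intro hkz
      exact hc (hzy k hkz hk.1 ▸ hk.2)
    · by_contra hc
      refine h2 (Mops.le_iff.2 fun k hk => ?_)
      by_contra hky
      exact hc (hzy k hk.2 hky ▸ hk.1)
  have hcompl : ∀ c ∈ C, ∀ v, v ∈ c.extent ∨ v ∈ c.intent := by
    intro c hc v
    obtain ⟨x, hx, x', hx', hxx', h1, h2⟩ := hv v
    rcases hC.1.total hc hx with hcx | hxc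
    · exact .inr (Mops.le_iff_intent.1 hcx h1)
    · rcases hC.1.total hx' hc with hcx | hcx
      · exact .inl (Mops.le_iff.1 hcx h2)
      · rcases hcx.eq_or_lt with rfl | hcx
        · exact .inl h2
        · obtain rfl := hxc.eq_of_not_lt fun h => hxx'.2 h hcx
          exact .inr h1
  intro y z hyz
  obtain ⟨x, hx, x', hx', hxx', h1, h2, h3, h4⟩ :=
    exists_covBy_of_isLeftModularElement hC hmod hyz
  -- The failed meet inequality gives a label `v` of `x ⋖ x'` in `z.extent`, and the failed join
  -- inequality a label `w` in `y.intent`. They coincide by uniqueness.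
  obtain ⟨v, ⟨hv, hvz⟩, hvy⟩ := Set.not_subset.1 (mt Mops.le_iff.2 h2)
  have hvx : v ∈ x.intent := (hcompl x hx v).resolve_left fun h =>
    hvy (Mops.le_iff.1 h1 ⟨h, hvz⟩)
  obtain ⟨w, hw, hwz⟩ := Set.not_subset.1 (mt Mops.le_iff_intent.2 h3)
  rw [Concept.intent_sup] at hw
  have hwx' : w ∈ x'.extent := (hcompl x' hx' w).resolve_right fun h => by
    refine hwz (Mops.le_iff_intent.1 h4 ?_)
    rw [Concept.intent_sup]
    exact ⟨hw.1, h⟩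
  obtain rfl := CovBy.label_unique hxx' ⟨hvx, hv⟩ ⟨hw.2, hwx'⟩
  exact ⟨v, hw.1, hvz⟩

/-! ### The chain of a linear extension -/

section Prefix

variable {l : List V}

/-- The maximal orthogonal pair whose extent consists of the first `k` vertices of a linear
extension. -/
def Mops.ofPrefix (hl : G.IsLinearExtension l) (k : ℕ) : G.Mops :=
  Mops.ofDownset {v | v ∈ l.take k} fun a ha b hab => by
    have h := hl.pairwise
    have hb := hl.mem b
    rw [← List.take_append_drop k l] at h hb
    exact (List.mem_append.1 hb).resolve_right fun hb' =>
      (List.pairwise_append.1 h).2.2 a ha b hb' hab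

theorem Mops.ofPrefix_extent (hl : G.IsLinearExtension l) (k : ℕ) :
    (Mops.ofPrefix hl k).extent = {v | v ∈ l.take k} := rfl

theorem Mops.ofPrefix_covBy (hl : G.IsLinearExtension l) {k : ℕ} (hk : k < l.length) :
    Mops.ofPrefix hl k ⋖ Mops.ofPrefix hl (k + 1) := by
  refine Mops.covBy_of_extent_eq_insert (g := l[k]) ?_ ?_
  · rw [Mops.ofPrefix_extent]
    intro h
    obtain ⟨j, hj, hjk⟩ := List.mem_take_iff_getElem.1 h
    have := (hl.nodup.getElem_inj_iff).1 hjk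
    omega
  · ext v
    simp only [Mops.ofPrefix_extent, Set.mem_insert_iff, Set.mem_ofPred_eq,
      List.take_add_one, List.mem_append, List.getElem?_eq_getElem hk]
    simp [or_comm]

theorem Mops.ofPrefix_mono (hl : G.IsLinearExtension l) : Monotone (Mops.ofPrefix hl) :=
  fun _ _ h => Mops.le_iff.2 fun _ hv => (List.take_prefix_take_left h).subset hv

theorem Mops.isMaxChain_ofPrefix (hl : G.IsLinearExtension l) :
    IsMaxChain (· ≤ ·) (Set.range (Mops.ofPrefix hl)) := by
  refine ⟨(Mops.ofPrefix_mono hl).isChain_range, fun t ht hsub => hsub.antisymm fun c hc => ?_⟩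
  have htot : ∀ k, c ≤ Mops.ofPrefix hl k ∨ Mops.ofPrefix hl k ≤ c := fun k =>
    ht.total hc (hsub ⟨k, rfl⟩)
  by_contra hcr
  have hle : ∀ k, k ≤ l.length → Mops.ofPrefix hl k ≤ c := by
    intro k
    induction k with
    | zero => exact fun _ => Mops.le_iff.2 fun v hv => by simp [Mops.ofPrefix_extent] at hv
    | succ k ih =>
      intro hk
      refine (htot (k + 1)).resolve_left fun h => ?_
      refine (Mops.ofPrefix_covBy hl hk).2 ((ih (by omega)).lt_of_ne ?_) (h.lt_of_ne ?_)
      · exact fun e => hcr ⟨k, e⟩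
      · exact fun e => hcr ⟨k + 1, e.symm⟩
  refine hcr ⟨l.length, (hle _ le_rfl).antisymm (Mops.le_iff.2 fun v _ => ?_)⟩
  simpa [Mops.ofPrefix_extent] using hl.mem v

theorem IsOverlapping.isLeftModularLattice [Finite V] (hG : G.IsOverlapping)
    (hl : G.IsLinearExtension l) : IsLeftModularLattice G.Mops := by
  refine ⟨_, Mops.isMaxChain_ofPrefix hl, ?_⟩
  rintro _ ⟨k, rfl⟩
  exact hG.isLeftModularElement fun v => Classical.em _

end Prefix

/-! ### Extremality -/

theorem supIrred_map {α β : Type*} [Lattice α] [Lattice β] (e : α ≃o β) {a : α}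
    (h : SupIrred a) : SupIrred (e a) := by
  refine ⟨fun hmin => h.1 fun b hb => ?_, fun b c hbc => ?_⟩
  · exact e.le_iff_le.1 (hmin (e.le_iff_le.2 hb))
  · have h1 : e.symm b ⊔ e.symm c = a := by
      rw [← map_sup, hbc, e.symm_apply_apply]
    exact (h.2 h1).imp e.symm_apply_eq.1 e.symm_apply_eq.1

theorem supIrred_map_iff {α β : Type*} [Lattice α] [Lattice β] (e : α ≃o β) {a : α} :
    SupIrred (e a) ↔ SupIrred a :=
  ⟨fun h => by simpa using supIrred_map e.symm h, supIrred_map e⟩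

/-- If `c` is below the concept of `v` and `v ∉ c.intent`, some `a ∈ c.extent` equals `v` or has
edges both to and from `v`, so `v ∈ c.extent`. In a join equal to this concept, `v` is missing from
one of the two intents. -/
theorem supIrred_ofObject (v : V) : SupIrred (Concept.ofObject G.NonEdge v) := by
  have hle : ∀ {c : G.Mops}, Concept.ofObject G.NonEdge v ≤ c ↔ v ∈ c.extent := fun {c} => by
    rw [Concept.ofObjects_le_iff, Set.singleton_subset_iff]
  have hv : v ∈ (Concept.ofObject G.NonEdge v).extent := hle.1 le_rfl
  have hself : ∀ {c : G.Mops}, c ≤ Concept.ofObject G.NonEdge v → v ∉ c.intent →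
      v ∈ c.extent := by
    intro c hc hvc
    rw [Mops.mem_intent_iff] at hvc
    push Not at hvc
    obtain ⟨a, ha, hav⟩ := hvc
    have hai : a ∉ (Concept.ofObject G.NonEdge v).intent :=
      Mops.notMem_intent (Mops.le_iff.1 hc ha)
    rw [Concept.intent_ofObjects, mem_upperPolar_singleton] at hai
    by_cases hne : v = a
    · exact hne ▸ ha
    have h1 : G.Adj v a := by
      by_contra h
      exact hai ⟨hne, h⟩
    have h2 : G.Adj a v := by
      by_contra h
      exact hav ⟨Ne.symm hne, h⟩
    exact absurd (le_of_adj h1) (not_le_of_lt (lt_of_adj h2))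
  refine ⟨fun hmin => ?_, fun b c hbc => ?_⟩
  · have : v ∈ (⊥ : G.Mops).extent := hle.1 (hmin bot_le)
    exact Mops.notMem_intent this (by simp)
  · have hvbc : v ∉ (b ⊔ c).intent := by
      rw [hbc]
      exact Mops.notMem_intent hv
    rw [Concept.intent_sup] at hvbc
    by_cases hvb : v ∈ b.intent
    · right
      have hcle := hbc ▸ le_sup_right (a := b) (b := c)
      exact hcle.antisymm (hle.2 (hself hcle fun h => hvbc ⟨hvb, h⟩))
    · left
      have hble := hbc ▸ le_sup_left (a := b) (b := c)
      exact hble.antisymm (hle.2 (hself hble hvb))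

theorem ofObject_injective : Function.Injective (Concept.ofObject G.NonEdge) := by
  intro v w hvw
  have hi : ∀ k, G.NonEdge v k ↔ G.NonEdge w k := fun k => by
    have := congrArg (k ∈ ·.intent) hvw
    simpa using this
  by_contra hne
  have h1 : G.Adj w v := by
    by_contra h
    exact ((hi v).2 ⟨Ne.symm hne, h⟩).1 rfl
  have h2 : G.Adj v w := by
    by_contra h
    exact ((hi w).1 ⟨hne, h⟩).1 rfl
  exact not_le_of_lt (lt_of_adj h1) (le_of_adj h2)

theorem exists_ofObject_eq [Finite V] {c : G.Mops} (hc : SupIrred c) :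
    ∃ v, Concept.ofObject G.NonEdge v = c := by
  have hs : c.extent.toFinite.toFinset.sup (Concept.ofObject G.NonEdge) = c := by
    refine le_antisymm (Finset.sup_le fun v hv => ?_) (Mops.le_iff.2 fun v hv => ?_)
    · rw [Concept.ofObjects_le_iff, Set.singleton_subset_iff]
      simpa using hv
    · have := Finset.le_sup (f := Concept.ofObject G.NonEdge)
        (c.extent.toFinite.mem_toFinset.2 hv)
      rwa [Concept.ofObjects_le_iff, Set.singleton_subset_iff] at this
  obtain ⟨v, -, hv⟩ := hc.finset_sup_eq hs
  exact ⟨v, hv⟩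

theorem card_supIrred [Finite V] (G : AcyclicDigraph V) :
    Nat.card {c : G.Mops // SupIrred c} = Nat.card V := by
  symm
  refine Nat.card_congr (Equiv.ofBijective
    (fun v => ⟨Concept.ofObject G.NonEdge v, supIrred_ofObject v⟩) ⟨fun v w h => ?_, ?_⟩)
  · exact ofObject_injective (congrArg Subtype.val h)
  · rintro ⟨c, hc⟩
    obtain ⟨v, hv⟩ := exists_ofObject_eq hc
    exact ⟨v, Subtype.ext hv⟩

theorem card_infIrred [Finite V] (G : AcyclicDigraph V) :
    Nat.card {c : G.Mops // InfIrred c} = Nat.card V := by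
  rw [← card_supIrred G.op]
  refine Nat.card_congr ((OrderDual.toDual.trans (Mops.opIso G).toEquiv).subtypeEquiv fun c => ?_)
  exact (supIrred_toDual.symm.trans (supIrred_map_iff (Mops.opIso G)).symm)

theorem isExtremal_mops [Finite V] {l : List V} (hl : G.IsLinearExtension l) :
    IsExtremal G.Mops := by
  have hlen : l.length = Nat.card V := by
    classical
    have : Fintype V := Fintype.ofFinite V
    rw [Nat.card_eq_fintype_card, ← List.toFinset_card_of_nodup hl.nodup]
    congr 1
    ext v
    simp [hl.mem]
  refine ⟨LTSeries.mk l.length (fun k => Mops.ofPrefix hl k)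
    (Fin.strictMono_iff_lt_succ.2 fun k => ?_),
    fun q => ?_, ?_, ?_⟩
  · simpa using (Mops.ofPrefix_covBy hl k.2).lt
  · have hmono : StrictMono fun c : G.Mops => c.extent.ncard := fun c d h =>
      Set.ncard_lt_ncard (Concept.extent_ssubset_extent_iff.2 h)
    have h1 := (q.map _ hmono).head_add_length_le_nat
    have h2 : q.last.extent.ncard ≤ Nat.card V := Set.ncard_le_card _
    simp only [LTSeries.head_map, LTSeries.last_map, LTSeries.map_length] at h1
    simp only [LTSeries.mk]
    omega
  · rw [card_supIrred]
    exact hlen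
  · rw [card_infIrred]
    exact hlen

theorem isTrim_mops_iff [Finite V] {l : List V} (hl : G.IsLinearExtension l) :
    IsTrim G.Mops ↔ G.IsOverlapping :=
  ⟨fun h => isOverlapping_of_isLeftModularLattice h.2,
    fun h => ⟨isExtremal_mops hl, h.isLeftModularLattice hl⟩⟩

end Trim

end AcyclicDigraph

theorem mainTheorem7 {V : Type*} [Finite V] (G : AcyclicDigraph V) (l l' : List V)
    (hl : G.IsLinearExtension l) (hl' : G.IsReverseLinearExtension l') :
    (IsTrim G.Mops ↔ IsLatticePoset (G.Tops l l')) ∧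
    (IsTrim G.Mops →
      (∀ x y : G.Mops, x ⋖ y → ∃! g, g ∈ x.intent ∩ y.extent) ∧
      ∃ φ : G.Mops ≃o G.Tops l l',
        ∀ x, (φ x).D = AcyclicDigraph.downLabels x ∧ (φ x).U = AcyclicDigraph.upLabels x) := by
  rw [AcyclicDigraph.isTrim_mops_iff hl]
  refine ⟨⟨fun h => h.isLatticePoset hl hl', fun h x y hxy =>
    AcyclicDigraph.exists_mem_inter_of_isLatticePoset hl hl' h hxy⟩,
    fun h => ⟨?_, h.exists_orderIso hl hl'⟩⟩
  intro x y hxy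
  obtain ⟨g, hg⟩ := h x y hxy
  exact ⟨g, hg, fun k hk => AcyclicDigraph.CovBy.label_unique hxy hk hg⟩
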